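/- Let $V$ be a reflexive separable (real) Banach space with dual $V^*$ and let $[0,T]$ be a time interval. Call $\Psi:V\to[0,+\infty)$ an admissible dissipation potential if $\Psi$ is lower semicontinuous and convex, $\Psi(0)=0$, $\Psi(v)/\|v\|\to+\infty$ as $\|v\|\to+\infty$, $\Psi^*(\xi)/\|\xi\|_*\to+\infty$ as $\|\xi\|_*\to+\infty$ (where $\Psi^*$ is the Fenchel–Moreau conjugate), and $\Psi^*(w_1)=\Psi^*(w_2)$ whenever $w_1,w_2\in\partial\Psi(v)$ for some $v\in V$, with $\partial\Psi$ the subdifferential of convex analysis. Let $\emptyset\ne D\subset V$ and let $\mathcal E:[0,T]\times V\to(-\infty,+\infty]$ have domain $\{\mathcal E<+\infty\}=[0,T]\times D$, with $u\mapsto\mathcal E_t(u)$ lower semicontinuous for every $t\in[0,T]$ and $\mathcal E_t(u)\ge C_0$ for all $(t,u)\in[0,T]\times D$ and some constant $C_0>0$. Let $\mathrm F:[0,T]\times D\rightrightarrows V^*$ be a multivalued map whose graph is a Borel subset of $[0,T]\times V\times V^*$. Let $(\Psi_w)_{w\in S}$, $S\subset V$, be a family of admissible dissipation potentials (e.g.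 $S=D$ or $S=V$). Suppose that: (i) $\partial\mathcal E_t(u)\subset\mathrm F_t(u)$ for every $(t,u)\in[0,T]\times D$, where $\partial\mathcal E_t(u)$ is the Fréchet subdifferential, i.e. the set of $\xi\in V^*$ with $\mathcal E_t(v)-\mathcal E_t(u)-\langle\xi,v-u\rangle\ge o(\|v-u\|)$ as $v\to u$ in $V$; (ii) $(\mathcal E,\mathrm F)$ is weakly closed: for all $t\in[0,T]$ and all sequences $u_n\in D$, $\xi_n\in\mathrm F_t(u_n)$ with $u_n\to u$ in $V$, $\xi_n\rightharpoonup\xi$ weakly in $V^*$ and $\mathcal E_t(u_n)\to\mathscr E$ in $\mathbb R$, one has $u\in D$, $\xi\in\mathrm F_t(u)$ and $\mathscr E=\mathcal E_t(u)$. Then the variational sum rule holds: for all $t\in[0,T]$, $u_o\in S$, $\tau>0$ and every minimizer $\bar u\in V$ of $u\mapsto\mathcal E_t(u)+\tau\Psi_{u_o}\big((u-u_o)/\tau\big)$ over $V$, there exists $\xi\in\mathrm F_t(\bar u)$ with $-\xi\in\partial\Psi_{u_o}\big((\bar u-u_o)/\tau\big)$. -/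

import Mathlib

open Set Filter Topology MeasureTheory

noncomputable section

/-- A real normed space is reflexive if the canonical embedding into its bidual is onto. -/
def IsReflexiveSpace (V : Type*) [NormedAddCommGroup V] [NormedSpace ℝ V] : Prop :=
  Function.Surjective (NormedSpace.inclusionInDoubleDual ℝ V)

/-- Subdifferential, in the sense of convex analysis, of a finite function `Ψ` at `v`. -/
def convexSubdiff {V : Type*} [NormedAddCommGroup V] [NormedSpace ℝ V]
    (Ψ : V → ℝ) (v : V) : Set (StrongDual ℝ V) :=
  {w | ∀ z : V, Ψ v + w (z - v) ≤ Ψ z}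

/-- Fenchel-Moreau conjugate `Ψ*(ξ) = sup_v (⟨ξ, v⟩ - Ψ(v))`, with values in `[-∞, +∞]`. -/
def fenchelConj {V : Type*} [NormedAddCommGroup V] [NormedSpace ℝ V]
    (Ψ : V → ℝ) (ξ : StrongDual ℝ V) : EReal :=
  ⨆ v : V, ((ξ v - Ψ v : ℝ) : EReal)

/-- Admissible dissipation potentials `Ψ : V → [0, +∞)`. -/
structure IsAdmissiblePotential {V : Type*} [NormedAddCommGroup V] [NormedSpace ℝ V]
    (Ψ : V → ℝ) : Prop where
  nonneg : ∀ v, 0 ≤ Ψ v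
  lsc : LowerSemicontinuous Ψ
  convex : ConvexOn ℝ univ Ψ
  map_zero : Ψ 0 = 0
  superlinear : Tendsto (fun v : V => Ψ v / ‖v‖) (Bornology.cobounded V) atTop
  conj_superlinear :
    Tendsto (fun ξ : StrongDual ℝ V => fenchelConj Ψ ξ / ((‖ξ‖ : ℝ) : EReal))
      (Bornology.cobounded (StrongDual ℝ V)) (𝓝 ⊤)
  conj_eq : ∀ v : V, ∀ w₁ ∈ convexSubdiff Ψ v, ∀ w₂ ∈ convexSubdiff Ψ v,
    fenchelConj Ψ w₁ = fenchelConj Ψ w₂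

/-- Fréchet subdifferential of an extended-real-valued function `f` at a point `u` where `f` is
finite: `f v - f u - ⟨ξ, v - u⟩ ≥ o(‖v - u‖)` as `v → u`. It is empty where `f` is infinite. -/
def frechetSubdiff {V : Type*} [NormedAddCommGroup V] [NormedSpace ℝ V]
    (f : V → EReal) (u : V) : Set (StrongDual ℝ V) :=
  {ξ | f u ≠ ⊤ ∧ f u ≠ ⊥ ∧ ∀ ε : ℝ, 0 < ε → ∀ᶠ v in 𝓝 u,
    f u + ((ξ (v - u) - ε * ‖v - u‖ : ℝ) : EReal) ≤ f v}

/-- Graph of the multivalued map `F : [0,T] × D ⇉ V*`. -/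
def multiGraph {V : Type*} [NormedAddCommGroup V] [NormedSpace ℝ V]
    (T : ℝ) (D : Set V) (F : ℝ → V → Set (StrongDual ℝ V)) :
    Set (ℝ × V × StrongDual ℝ V) :=
  {p | p.1 ∈ Icc 0 T ∧ p.2.1 ∈ D ∧ p.2.2 ∈ F p.1 p.2.1}

/-- Domain of the multivalued map `F : [0,T] × D ⇉ V*`. -/
def multiDom {V : Type*} [NormedAddCommGroup V] [NormedSpace ℝ V]
    (T : ℝ) (D : Set V) (F : ℝ → V → Set (StrongDual ℝ V)) : Set (ℝ × V) :=
  {p | p.1 ∈ Icc 0 T ∧ p.2 ∈ D ∧ (F p.1 p.2).Nonempty}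

/-- Basic conditions on the energy `E : [0,T] × V → (-∞, +∞]` with domain `[0,T] × D` and on the
multivalued map `F`. Only the values of `E` and `F` at times in `[0,T]` matter. -/
structure IsEnergy {V : Type*} [NormedAddCommGroup V] [NormedSpace ℝ V]
    (T : ℝ) (D : Set V) (E : ℝ → V → EReal) (F : ℝ → V → Set (StrongDual ℝ V)) : Prop where
  dom_nonempty : D.Nonempty
  dom_eq : ∀ t ∈ Icc 0 T, ∀ u : V, E t u ≠ ⊤ ↔ u ∈ D
  lsc : ∀ t ∈ Icc 0 T, LowerSemicontinuous (E t)
  bounded_below : ∃ C₀ : ℝ, 0 < C₀ ∧ ∀ t ∈ Icc 0 T, ∀ u ∈ D, (C₀ : EReal) ≤ E t u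
  borel_graph : MeasurableSet[borel (ℝ × V × StrongDual ℝ V)] (multiGraph T D F)

/-- Weak closedness of the pair `(E, F)`: strong convergence in `V`, weak convergence in `V*` and
convergence of the (real) energies. -/
def IsWeaklyClosedPair {V : Type*} [NormedAddCommGroup V] [NormedSpace ℝ V]
    (T : ℝ) (D : Set V) (E : ℝ → V → EReal) (F : ℝ → V → Set (StrongDual ℝ V)) : Prop :=
  ∀ t ∈ Icc 0 T, ∀ (us : ℕ → V) (ξs : ℕ → StrongDual ℝ V) (es : ℕ → ℝ)
    (u : V) (ξ : StrongDual ℝ V) (e : ℝ),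
    (∀ n, (t, us n, ξs n) ∈ multiGraph T D F) →
    (∀ n, (es n : EReal) = E t (us n)) →
    Tendsto us atTop (𝓝 u) →
    Tendsto (fun n => toWeakSpace ℝ (StrongDual ℝ V) (ξs n)) atTop
      (𝓝 (toWeakSpace ℝ (StrongDual ℝ V) ξ)) →
    Tendsto es atTop (𝓝 e) →
    (t, u) ∈ multiDom T D F ∧ ξ ∈ F t u ∧ (e : EReal) = E t u

end

/-!
The dual of a reflexive separable space `V` is separable, so it carries a weak-star lower
semicontinuous, locally uniformly convex function comparable to `‖ξ‖ ^ 2`; its conjugate `h` is a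
Fréchet differentiable function on `V` comparable to `‖x‖ ^ 2`.

Let `x` be a local minimizer of `f + g`, with `g` convex and continuous. Applied to the decoupled
functional `f u + g v + N * h (u - v)`, the Borwein–Preiss principle gives, for large `N`, a
minimizer `(u, v)` near `(x, x)` of a slight smooth perturbation. The two partial derivatives of the
penalty are opposite, so `f` at `u` and `g` at `v` have almost opposite subgradients. Those of `g`
are bounded because `g` is locally Lipschitz; in the weak limit, `x` has a limiting subgradient of
`f` whose opposite is a subgradient of `g`. An extended-valued `f` is reduced to a real-valued one
by replacing it with `min f c` for some real `c > f x`. When `f` is the energy, weak closedness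
places the limiting subgradient in `F`.
-/

section SeparableDual

variable {V : Type*} [NormedAddCommGroup V] [NormedSpace ℝ V]

variable (V) in
theorem exists_seq_dual_separating [TopologicalSpace.SeparableSpace V] :
    ∃ e : ℕ → StrongDual ℝ V, ∀ v, (∀ n, e n v = 0) → v = 0 := by
  obtain ⟨y, hy⟩ := TopologicalSpace.exists_dense_seq V
  choose e he_norm he_eq using fun n => exists_dual_vector'' ℝ (y n)
  refine ⟨e, fun v hv => norm_eq_zero.1 (le_antisymm (le_of_forall_pos_le_add fun ε hε => ?_)
    (norm_nonneg v))⟩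
  obtain ⟨n, hn⟩ := hy.exists_dist_lt v (half_pos hε)
  rw [dist_eq_norm] at hn
  have hyn : ‖y n‖ ≤ ‖v - y n‖ :=
    calc ‖y n‖ = e n (y n - v) := by simp [he_eq, hv]
      _ ≤ ‖e n (y n - v)‖ := Real.le_norm_self _
      _ ≤ 1 * ‖y n - v‖ := (e n).le_of_opNorm_le (he_norm n) _
      _ = ‖v - y n‖ := by rw [one_mul, norm_sub_rev]
  linarith [norm_le_norm_sub_add v (y n)]

variable (V) in
theorem exists_seq_unitBall_separating_dual [TopologicalSpace.SeparableSpace V] :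
    ∃ x : ℕ → V, (∀ n, ‖x n‖ ≤ 1) ∧ ∀ ξ : StrongDual ℝ V, (∀ n, ξ (x n) = 0) → ξ = 0 := by
  obtain ⟨y, hy⟩ := TopologicalSpace.exists_dense_seq V
  have hpos : ∀ n, 0 < 1 + ‖y n‖ := fun n => by positivity
  refine ⟨fun n => (1 + ‖y n‖)⁻¹ • y n, fun n => ?_, fun ξ hξ => ?_⟩
  · rw [norm_smul, norm_inv, Real.norm_of_nonneg (hpos n).le, inv_mul_le_one₀ (hpos n)]
    linarith
  · have hξy : ∀ n, ξ (y n) = 0 := fun n => by simpa [(hpos n).ne'] using hξ n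
    exact DFunLike.coe_injective
      (hy.equalizer ξ.continuous continuous_zero (funext hξy))

theorem IsReflexiveSpace.topologicalClosure_eq_top_of_separating (hV : IsReflexiveSpace V)
    {W : Submodule ℝ (StrongDual ℝ V)} (hW : ∀ v, (∀ ξ ∈ W, ξ v = 0) → v = 0) :
    W.topologicalClosure = ⊤ := by
  refine Submodule.eq_top_iff'.2 fun ξ => by_contra fun hξ => ?_
  obtain ⟨φ, c, hφ, hc⟩ := geometric_hahn_banach_closed_point
    W.topologicalClosure.convex W.isClosed_topologicalClosure hξ
  have hc_pos : 0 < c := by simpa using hφ 0 (zero_mem _)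
  have hφW : ∀ η ∈ W, φ η = 0 := fun η hη => by_contra fun hne => by
    have := hφ ((c / φ η) • η) (W.le_topologicalClosure (W.smul_mem _ hη))
    rw [map_smul, smul_eq_mul, div_mul_cancel₀ _ hne] at this
    exact lt_irrefl _ this
  obtain ⟨v, rfl⟩ := hV φ
  rw [hW v hφW, map_zero] at hc
  exact hc_pos.not_gt hc

theorem IsReflexiveSpace.separableSpace_dual [TopologicalSpace.SeparableSpace V]
    (hV : IsReflexiveSpace V) : TopologicalSpace.SeparableSpace (StrongDual ℝ V) := by
  obtain ⟨e, he⟩ := exists_seq_dual_separating V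
  have hdense : (Submodule.span ℝ (range e)).topologicalClosure = ⊤ :=
    hV.topologicalClosure_eq_top_of_separating fun v hv =>
      he v fun n => hv _ (Submodule.subset_span (mem_range_self n))
  rw [← TopologicalSpace.isSeparable_univ_iff, ← Submodule.top_coe (R := ℝ), ← hdense,
    Submodule.topologicalClosure_coe]
  exact ((countable_range e).isSeparable.span).closure

end SeparableDual

section TailSeminorm

variable {V : Type*} [NormedAddCommGroup V] [NormedSpace ℝ V]

/-- The common kernel of the first `n` functionals of a sequence. -/
def kernelTail (e : ℕ → StrongDual ℝ V) (n : ℕ) : Submodule ℝ V :=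
  ⨅ i : Fin n, (e i : V →ₗ[ℝ] ℝ).ker

/-- The norm of the restriction of a functional to the common kernel of `e 0, …, e (n - 1)`, which
is its distance to the span of these functionals. -/
noncomputable def tailSeminorm (e : ℕ → StrongDual ℝ V) (n : ℕ) : Seminorm ℝ (StrongDual ℝ V) :=
  (normSeminorm ℝ (StrongDual ℝ (kernelTail e n))).comp
    (ContinuousLinearMap.precomp ℝ (kernelTail e n).subtypeL :
      StrongDual ℝ V →L[ℝ] StrongDual ℝ (kernelTail e n)).toLinearMap

variable {e : ℕ → StrongDual ℝ V} {n : ℕ}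

theorem mem_kernelTail {v : V} : v ∈ kernelTail e n ↔ ∀ i < n, e i v = 0 := by
  simp only [kernelTail, Submodule.mem_iInf, LinearMap.mem_ker]
  exact ⟨fun h i hi => h ⟨i, hi⟩, fun h i => h i i.2⟩

theorem tailSeminorm_apply (ξ : StrongDual ℝ V) :
    tailSeminorm e n ξ = ‖ξ.comp (kernelTail e n).subtypeL‖ := rfl

theorem tailSeminorm_le_iff {ξ : StrongDual ℝ V} {r : ℝ} (hr : 0 ≤ r) :
    tailSeminorm e n ξ ≤ r ↔ ∀ v ∈ kernelTail e n, |ξ v| ≤ r * ‖v‖ := by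
  rw [tailSeminorm_apply, ContinuousLinearMap.opNorm_le_iff hr]
  simp

theorem tailSeminorm_le_norm (ξ : StrongDual ℝ V) : tailSeminorm e n ξ ≤ ‖ξ‖ :=
  (tailSeminorm_le_iff (norm_nonneg ξ)).2 fun v _ => ξ.le_opNorm v

theorem tailSeminorm_zero (ξ : StrongDual ℝ V) : tailSeminorm e 0 ξ = ‖ξ‖ := by
  refine (tailSeminorm_le_norm ξ).antisymm
    (ξ.opNorm_le_bound (apply_nonneg _ ξ) fun v => ?_)
  exact (tailSeminorm_le_iff (apply_nonneg _ ξ)).1 le_rfl v (mem_kernelTail.2 (by simp))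

theorem tailSeminorm_apply_of_lt {i : ℕ} (hi : i < n) : tailSeminorm e n (e i) = 0 :=
  ((tailSeminorm_le_iff le_rfl).2 fun v hv => by simp [mem_kernelTail.1 hv i hi]).antisymm
    (apply_nonneg _ _)

theorem exists_tailSeminorm_lt (he : DenseRange e) (ξ : StrongDual ℝ V) {ε : ℝ} (hε : 0 < ε) :
    ∃ n, tailSeminorm e n ξ < ε := by
  obtain ⟨i, hi⟩ := he.exists_dist_lt ξ hε
  refine ⟨i + 1, ?_⟩
  calc tailSeminorm e (i + 1) ξ
      ≤ tailSeminorm e (i + 1) (ξ - e i) + tailSeminorm e (i + 1) (e i) := by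
        simpa using map_add_le_add (tailSeminorm e (i + 1)) (ξ - e i) (e i)
    _ = tailSeminorm e (i + 1) (ξ - e i) := by
        rw [tailSeminorm_apply_of_lt i.lt_succ_self, add_zero]
    _ ≤ ‖ξ - e i‖ := tailSeminorm_le_norm _
    _ < ε := by rwa [← dist_eq_norm]

theorem exists_norm_eq_tailSeminorm (e : ℕ → StrongDual ℝ V) (n : ℕ) (ξ : StrongDual ℝ V) :
    ∃ η : StrongDual ℝ V, ‖η‖ = tailSeminorm e n ξ ∧
      ξ - η ∈ Submodule.span ℝ (range fun i : Fin n => e i) := by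
  obtain ⟨η, hη, hη_norm⟩ := exists_extension_norm_eq (kernelTail e n)
    (ξ.comp (kernelTail e n).subtypeL)
  refine ⟨η, hη_norm, ?_⟩
  have hspan : ((ξ - η : StrongDual ℝ V) : V →ₗ[ℝ] ℝ) ∈
      Submodule.span ℝ (range fun i : Fin n => (e i : V →ₗ[ℝ] ℝ)) :=
    mem_span_of_iInf_ker_le_ker fun v hv => by
      have : η v = ξ v := hη ⟨v, hv⟩
      simp [this]
  rw [Submodule.mem_span_range_iff_exists_fun] at hspan ⊢
  obtain ⟨c, hc⟩ := hspan
  exact ⟨c, ContinuousLinearMap.coe_injective (by simpa using hc)⟩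

theorem lowerSemicontinuous_tailSeminorm (e : ℕ → StrongDual ℝ V) (n : ℕ) :
    LowerSemicontinuous fun ξ : WeakDual ℝ V => tailSeminorm e n (WeakDual.toStrongDual ξ) := by
  refine lowerSemicontinuous_iff_isClosed_preimage.2 fun r => ?_
  rcases lt_or_ge r 0 with hr | hr
  · convert isClosed_empty using 1
    exact eq_empty_of_forall_notMem fun ξ hξ => (hr.trans_le (apply_nonneg _ _)).not_ge hξ
  · have : (fun ξ : WeakDual ℝ V => tailSeminorm e n (WeakDual.toStrongDual ξ)) ⁻¹' Iic r =
        ⋂ v ∈ kernelTail e n, {ξ : WeakDual ℝ V | |ξ v| ≤ r * ‖v‖} := by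
      ext ξ
      simp only [mem_preimage, mem_Iic, mem_iInter, mem_ofPred_eq]
      exact tailSeminorm_le_iff hr
    rw [this]
    exact isClosed_biInter fun v _ => isClosed_le (WeakDual.eval_continuous v).abs continuous_const

end TailSeminorm

section LocallyUniformlyConvex

variable {E : Type*} [NormedAddCommGroup E] [NormedSpace ℝ E]

/-- The defect of midpoint convexity of `k` on the segment from `a` to `b`, doubled. -/
noncomputable def convexityGap (k : E → ℝ) (a b : E) : ℝ :=
  k a + k b - 2 * k ((2⁻¹ : ℝ) • (a + b))

/-- Local uniform convexity of a function: it is midpoint convex and, at every point `a`, a small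
convexity gap between `a` and `b` forces `b` to be close to `a`. -/
structure IsLocallyUniformlyConvex (k : E → ℝ) : Prop where
  convexityGap_nonneg : ∀ a b, 0 ≤ convexityGap k a b
  comap_convexityGap_le : ∀ a, comap (convexityGap k a) (𝓝 0) ≤ 𝓝 a

theorem IsLocallyUniformlyConvex.tendsto {ι : Type*} {l : Filter ι} {k : E → ℝ} {a : E}
    {b : ι → E} {c : ι → ℝ} (hk : IsLocallyUniformlyConvex k)
    (hb : ∀ i, convexityGap k a (b i) ≤ c i) (hc : Tendsto c l (𝓝 0)) : Tendsto b l (𝓝 a) := by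
  have hgap : Tendsto (fun i => convexityGap k a (b i)) l (𝓝 0) :=
    squeeze_zero (fun i => hk.convexityGap_nonneg a (b i)) hb hc
  exact (tendsto_comap_iff.2 hgap).mono_right (hk.comap_convexityGap_le a)

theorem convexityGap_const_mul_add (c : ℝ) (k l : E → ℝ) (a b : E) :
    convexityGap (fun ξ => c * (k ξ + l ξ)) a b =
      c * (convexityGap k a b + convexityGap l a b) := by
  simp only [convexityGap]
  ring

theorem sq_sub_le_convexityGap_sq_seminorm (p : Seminorm ℝ E) (a b : E) :
    (p a - p b) ^ 2 / 2 ≤ convexityGap (fun ξ => p ξ ^ 2) a b := by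
  have hmid : p ((2⁻¹ : ℝ) • (a + b)) ≤ (p a + p b) / 2 := by
    rw [map_smul_eq_mul, norm_inv, Real.norm_two]
    linarith [map_add_le_add p a b]
  have hmid_sq := pow_le_pow_left₀ (apply_nonneg p _) hmid 2
  simp only [convexityGap]
  linarith

theorem convexityGap_sq_linearMap (φ : E →ₗ[ℝ] ℝ) (a b : E) :
    convexityGap (fun ξ => φ ξ ^ 2) a b = (φ a - φ b) ^ 2 / 2 := by
  simp only [convexityGap, map_smul, map_add, smul_eq_mul]
  ring

theorem convexityGap_le_convexityGap_tsum {ι : Type*} {s : ι → E → ℝ} {a b : E}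
    (hs : ∀ ξ, Summable fun i => s i ξ) (hgap : ∀ i, 0 ≤ convexityGap (s i) a b) (i : ι) :
    convexityGap (s i) a b ≤ convexityGap (fun ξ => ∑' i, s i ξ) a b :=
  le_hasSum (((hs a).hasSum.add (hs b).hasSum).sub ((hs _).hasSum.mul_left 2)) i fun j _ => hgap j

end LocallyUniformlyConvex

theorem filter_totallyBounded_of_eventually_near {E : Type*} [PseudoMetricSpace E] {l : Filter E}
    (h : ∀ ε > 0, ∃ K : Set E, TotallyBounded K ∧ ∀ᶠ b in l, ∃ w ∈ K, dist b w < ε) :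
    l.TotallyBounded := by
  refine (Metric.uniformity_basis_dist.filter_totallyBounded_iff).2 fun ε hε => ?_
  obtain ⟨K, hK, hl⟩ := h (ε / 2) (half_pos hε)
  obtain ⟨t, ht, hKt⟩ := Metric.totallyBounded_iff.1 hK (ε / 2) (half_pos hε)
  refine ⟨t, ht, hl.mono ?_⟩
  rintro b ⟨w, hwK, hbw⟩
  obtain ⟨y, hy, hwy⟩ := mem_iUnion₂.1 (hKt hwK)
  exact ⟨y, hy, (dist_triangle b w y).trans_lt (by linarith [Metric.mem_ball.1 hwy])⟩

theorem lowerSemicontinuous_tsum_of_nonneg {X : Type*} [TopologicalSpace X] {s : ℕ → X → ℝ}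
    (hlsc : ∀ n, LowerSemicontinuous (s n)) (hnonneg : ∀ n x, 0 ≤ s n x)
    (hsum : ∀ x, Summable fun n => s n x) : LowerSemicontinuous fun x => ∑' n, s n x := by
  have hbdd : ∀ x, BddAbove (range fun N => ∑ n ∈ Finset.range N, s n x) := fun x =>
    ⟨∑' n, s n x, forall_mem_range.2 fun N => (hsum x).sum_le_tsum _ fun n _ => hnonneg n x⟩
  have hsup : ∀ x, ∑' n, s n x = ⨆ N, ∑ n ∈ Finset.range N, s n x := fun x =>
    tendsto_nhds_unique (hsum x).hasSum.tendsto_sum_nat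
      (tendsto_atTop_ciSup
        (monotone_nat_of_le_succ fun N => by
          rw [Finset.sum_range_succ]; exact le_add_of_nonneg_right (hnonneg N x))
        (hbdd x))
  simp only [hsup]
  exact lowerSemicontinuous_ciSup hbdd fun N => lowerSemicontinuous_sum fun n _ => hlsc n

theorem lowerSemicontinuous_sq_of_nonneg {X : Type*} [TopologicalSpace X] {f : X → ℝ}
    (hf : LowerSemicontinuous f) (hnonneg : ∀ x, 0 ≤ f x) :
    LowerSemicontinuous fun x => f x ^ 2 := by
  have hmono : Monotone fun t : ℝ => max t 0 ^ 2 := fun t t' h =>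
    pow_le_pow_left₀ (le_max_right _ _) (max_le_max_right 0 h) 2
  have hcont : Continuous fun t : ℝ => max t 0 ^ 2 := by fun_prop
  simpa only [Function.comp_def, max_eq_left (hnonneg _)] using
    hcont.comp_lowerSemicontinuous hf hmono

theorem tendsto_of_sq_sub_le {ι : Type*} {l : Filter ι} {u c : ι → ℝ} {a : ℝ}
    (hu : ∀ i, (a - u i) ^ 2 ≤ c i) (hc : Tendsto c l (𝓝 0)) : Tendsto u l (𝓝 a) := by
  refine tendsto_iff_dist_tendsto_zero.2 (squeeze_zero (fun _ => dist_nonneg) (fun i => ?_)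
    (by simpa using hc.sqrt))
  rw [dist_comm, Real.dist_eq]
  exact Real.abs_le_sqrt (hu i)

section DualEnergy

variable {V : Type*} [NormedAddCommGroup V] [NormedSpace ℝ V]

/-- The `n`-th term of `dualEnergy`. -/
noncomputable def dualEnergyTerm (e : ℕ → StrongDual ℝ V) (x : ℕ → V) (n : ℕ)
    (ξ : StrongDual ℝ V) : ℝ :=
  (1 / 2) ^ (n + 4) * (tailSeminorm e n ξ ^ 2 + ξ (x n) ^ 2)

/-- A function of Troyanski–Kadec type on the dual space, comparable to the square of the norm; it
is locally uniformly convex when `e` is dense and `x` separates functionals. The offset `4` in the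
exponent makes it at most `‖ξ‖ ^ 2 / 4`, hence its conjugate at least `‖x‖ ^ 2`. -/
noncomputable def dualEnergy (e : ℕ → StrongDual ℝ V) (x : ℕ → V) (ξ : StrongDual ℝ V) : ℝ :=
  ∑' n, dualEnergyTerm e x n ξ

variable {e : ℕ → StrongDual ℝ V} {x : ℕ → V}

theorem dualEnergyTerm_nonneg (n : ℕ) (ξ : StrongDual ℝ V) : 0 ≤ dualEnergyTerm e x n ξ := by
  unfold dualEnergyTerm
  positivity

theorem dualEnergyTerm_le (hx : ∀ n, ‖x n‖ ≤ 1) (n : ℕ) (ξ : StrongDual ℝ V) :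
    dualEnergyTerm e x n ξ ≤ (1 / 2) ^ n * (‖ξ‖ ^ 2 / 8) := by
  have htail : tailSeminorm e n ξ ^ 2 ≤ ‖ξ‖ ^ 2 :=
    pow_le_pow_left₀ (apply_nonneg _ _) (tailSeminorm_le_norm _) 2
  have heval : ξ (x n) ^ 2 ≤ ‖ξ‖ ^ 2 := by
    rw [← sq_abs]
    exact pow_le_pow_left₀ (abs_nonneg _) ((ξ.le_opNorm_of_le (hx n)).trans_eq (mul_one _)) 2
  calc dualEnergyTerm e x n ξ ≤ (1 / 2) ^ (n + 4) * (‖ξ‖ ^ 2 + ‖ξ‖ ^ 2) := by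
        unfold dualEnergyTerm; gcongr
    _ = (1 / 2) ^ n * (‖ξ‖ ^ 2 / 8) := by ring

theorem summable_dualEnergyTerm (hx : ∀ n, ‖x n‖ ≤ 1) (ξ : StrongDual ℝ V) :
    Summable fun n => dualEnergyTerm e x n ξ :=
  .of_nonneg_of_le (dualEnergyTerm_nonneg · ξ) (dualEnergyTerm_le hx · ξ)
    (summable_geometric_two.mul_right _)

theorem dualEnergy_le (hx : ∀ n, ‖x n‖ ≤ 1) (ξ : StrongDual ℝ V) :
    dualEnergy e x ξ ≤ ‖ξ‖ ^ 2 / 4 :=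
  calc dualEnergy e x ξ ≤ ∑' n : ℕ, (1 / 2) ^ n * (‖ξ‖ ^ 2 / 8) :=
        (summable_dualEnergyTerm hx ξ).tsum_le_tsum (dualEnergyTerm_le hx · ξ)
          (summable_geometric_two.mul_right _)
    _ = ‖ξ‖ ^ 2 / 4 := by rw [tsum_mul_right, tsum_geometric_two]; ring

theorem le_dualEnergy (hx : ∀ n, ‖x n‖ ≤ 1) (ξ : StrongDual ℝ V) :
    ‖ξ‖ ^ 2 / 16 ≤ dualEnergy e x ξ :=
  calc ‖ξ‖ ^ 2 / 16 ≤ dualEnergyTerm e x 0 ξ := by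
        rw [dualEnergyTerm, tailSeminorm_zero]
        linarith [sq_nonneg (ξ (x 0))]
    _ ≤ dualEnergy e x ξ :=
        (summable_dualEnergyTerm hx ξ).le_tsum 0 fun n _ => dualEnergyTerm_nonneg n ξ

theorem lowerSemicontinuous_dualEnergy (hx : ∀ n, ‖x n‖ ≤ 1) :
    LowerSemicontinuous fun ξ : WeakDual ℝ V => dualEnergy e x (WeakDual.toStrongDual ξ) := by
  refine lowerSemicontinuous_tsum_of_nonneg (fun n => ?_) (fun n ξ => dualEnergyTerm_nonneg n _)
    fun ξ => summable_dualEnergyTerm hx _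
  have htail : LowerSemicontinuous fun ξ : WeakDual ℝ V =>
      tailSeminorm e n (WeakDual.toStrongDual ξ) ^ 2 :=
    lowerSemicontinuous_sq_of_nonneg (lowerSemicontinuous_tailSeminorm e n) fun _ =>
      apply_nonneg _ _
  have heval : Continuous fun ξ : WeakDual ℝ V => (WeakDual.toStrongDual ξ) (x n) ^ 2 :=
    (WeakDual.eval_continuous (x n)).pow 2
  exact (continuous_const_mul _).comp_lowerSemicontinuous (htail.add heval.lowerSemicontinuous)
    (monotone_mul_left_of_nonneg (by positivity))

theorem sq_sub_add_sq_sub_le_convexityGap_dualEnergy (hx : ∀ n, ‖x n‖ ≤ 1)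
    (a b : StrongDual ℝ V) (n : ℕ) :
    (tailSeminorm e n a - tailSeminorm e n b) ^ 2 + (a (x n) - b (x n)) ^ 2 ≤
      2 ^ (n + 5) * convexityGap (dualEnergy e x) a b := by
  have hterm : ∀ m, (1 / 2) ^ (m + 4) * ((tailSeminorm e m a - tailSeminorm e m b) ^ 2 / 2 +
      (a (x m) - b (x m)) ^ 2 / 2) ≤ convexityGap (dualEnergyTerm e x m) a b := fun m => by
    have htail := sq_sub_le_convexityGap_sq_seminorm (tailSeminorm e m) a b
    have heval := convexityGap_sq_linearMap
      (ContinuousLinearMap.apply ℝ ℝ (x m) : StrongDual ℝ V →ₗ[ℝ] ℝ) a b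
    simp only [ContinuousLinearMap.coe_coe, ContinuousLinearMap.apply_apply] at heval
    unfold dualEnergyTerm
    rw [convexityGap_const_mul_add, heval]
    gcongr
  have hgap := (hterm n).trans (convexityGap_le_convexityGap_tsum (summable_dualEnergyTerm hx)
    (fun m => le_trans (by positivity) (hterm m)) n)
  calc (tailSeminorm e n a - tailSeminorm e n b) ^ 2 + (a (x n) - b (x n)) ^ 2
      = 2 ^ (n + 5) * ((1 / 2) ^ (n + 4) * ((tailSeminorm e n a - tailSeminorm e n b) ^ 2 / 2 +
          (a (x n) - b (x n)) ^ 2 / 2)) := by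
        rw [one_div, inv_pow]
        field_simp
        ring
    _ ≤ 2 ^ (n + 5) * convexityGap (dualEnergy e x) a b :=
        mul_le_mul_of_nonneg_left hgap (by positivity)

-- A functional is its tail part, which is eventually small along `l`, plus an element of a bounded
-- set in the finite-dimensional span of `e 0, …, e (n - 1)`.
theorem filter_totallyBounded_of_tendsto_tailSeminorm (he : DenseRange e)
    {l : Filter (StrongDual ℝ V)} {a : StrongDual ℝ V}
    (hl : ∀ n, Tendsto (tailSeminorm e n) l (𝓝 (tailSeminorm e n a))) : l.TotallyBounded := by
  refine filter_totallyBounded_of_eventually_near fun ε hε => ?_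
  obtain ⟨n, hn⟩ := exists_tailSeminorm_lt he a hε
  set W := Submodule.span ℝ (range fun i : Fin n => e i)
  have : FiniteDimensional ℝ W := .span_of_finite ℝ (finite_range _)
  have : ProperSpace W := FiniteDimensional.proper ℝ W
  refine ⟨W.subtypeL '' Metric.closedBall 0 (‖a‖ + 1 + ε),
    ((isCompact_closedBall _ _).image W.subtypeL.continuous).totallyBounded, ?_⟩
  filter_upwards [(hl n).eventually_lt_const hn,
    (hl 0).eventually_lt_const (lt_add_one _)] with b hb_tail hb_norm
  rw [tailSeminorm_zero, tailSeminorm_zero] at hb_norm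
  obtain ⟨η, hη, hbη⟩ := exists_norm_eq_tailSeminorm e n b
  refine ⟨b - η, ⟨⟨b - η, hbη⟩, (mem_closedBall_zero_iff (E := W)).2 ?_, rfl⟩, ?_⟩
  · exact (norm_sub_le b η).trans (by linarith)
  · rwa [dist_eq_norm, sub_sub_cancel, hη]

theorem isLocallyUniformlyConvex_dualEnergy (he : DenseRange e) (hx : ∀ n, ‖x n‖ ≤ 1)
    (hsep : ∀ ξ : StrongDual ℝ V, (∀ n, ξ (x n) = 0) → ξ = 0) :
    IsLocallyUniformlyConvex (dualEnergy e x) := by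
  refine ⟨fun a b => ?_, fun a => le_iff_ultrafilter.2 fun U hU => ?_⟩
  · exact nonneg_of_mul_nonneg_right ((add_nonneg (sq_nonneg _) (sq_nonneg _)).trans
      (sq_sub_add_sq_sub_le_convexityGap_dualEnergy hx a b 0)) (by positivity)
  have hgap : ∀ n, Tendsto (fun b => 2 ^ (n + 5) * convexityGap (dualEnergy e x) a b) U (𝓝 0) :=
    fun n => by simpa using (tendsto_comap.mono_left hU).const_mul ((2 : ℝ) ^ (n + 5))
  have hbound := sq_sub_add_sq_sub_le_convexityGap_dualEnergy (e := e) hx a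
  have htail : ∀ n, Tendsto (tailSeminorm e n) U (𝓝 (tailSeminorm e n a)) := fun n =>
    tendsto_of_sq_sub_le
      (fun b => (le_add_of_nonneg_right (sq_nonneg _)).trans (hbound b n)) (hgap n)
  have heval : ∀ n, Tendsto (fun b : StrongDual ℝ V => b (x n)) U (𝓝 (a (x n))) := fun n =>
    tendsto_of_sq_sub_le
      (fun b => (le_add_of_nonneg_left (sq_nonneg _)).trans (hbound b n)) (hgap n)
  obtain ⟨a', ha'⟩ := CompleteSpace.complete
    (U.cauchy_of_totallyBounded' (filter_totallyBounded_of_tendsto_tailSeminorm he htail))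
  have ha : a' - a = 0 := hsep _ fun n => sub_eq_zero.2 <| tendsto_nhds_unique
    (((ContinuousLinearMap.apply ℝ ℝ (x n)).continuous.tendsto a').mono_left ha') (heval n)
  rwa [← sub_eq_zero.1 ha]

end DualEnergy

section SmoothGauge

variable {V : Type*} [NormedAddCommGroup V] [NormedSpace ℝ V]

/-- A differentiable substitute for the square of the norm, with derivative of linear growth. -/
structure IsSmoothGauge (C : ℝ) (h : V → ℝ) : Prop where
  map_zero : h 0 = 0
  norm_sq_le : ∀ x, ‖x‖ ^ 2 ≤ h x
  differentiable : Differentiable ℝ h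
  norm_fderiv_le : ∀ x, ‖fderiv ℝ h x‖ ≤ C * ‖x‖

theorem dual_apply_le_norm_mul_norm (ξ : StrongDual ℝ V) (x : V) : ξ x ≤ ‖ξ‖ * ‖x‖ :=
  (Real.le_norm_self _).trans (ξ.le_opNorm x)

theorem exists_isMaxOn_eval_sub {k : StrongDual ℝ V → ℝ} {c : ℝ}
    (hlsc : LowerSemicontinuous fun ξ : WeakDual ℝ V => k (WeakDual.toStrongDual ξ))
    (hk0 : k 0 ≤ 0) (hc : 0 < c) (hk : ∀ ξ, c * ‖ξ‖ ^ 2 ≤ k ξ) (x : V) :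
    ∃ ξ, ‖ξ‖ ≤ c⁻¹ * ‖x‖ ∧ IsMaxOn (fun η => η x - k η) univ ξ := by
  have hlsc_sub : LowerSemicontinuous fun ξ : WeakDual ℝ V =>
      k (WeakDual.toStrongDual ξ) + -(ξ x) :=
    hlsc.add (WeakDual.eval_continuous x).neg.lowerSemicontinuous
  obtain ⟨ξ, hξ, hmin⟩ := LowerSemicontinuousOn.exists_isMinOn
    (s := WeakDual.toStrongDual ⁻¹' Metric.closedBall (0 : StrongDual ℝ V) (c⁻¹ * ‖x‖))
    ⟨0, Metric.mem_closedBall_self (α := StrongDual ℝ V) (by positivity)⟩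
    (WeakDual.isCompact_closedBall _ _) (hlsc_sub.lowerSemicontinuousOn _)
  have hball : ∀ η : StrongDual ℝ V, ‖η‖ ≤ c⁻¹ * ‖x‖ →
      η x - k η ≤ (WeakDual.toStrongDual ξ) x - k (WeakDual.toStrongDual ξ) := fun η hη => by
    have : k (WeakDual.toStrongDual ξ) + -(ξ x) ≤ k η + -(η x) :=
      hmin (a := StrongDual.toWeakDual η) (by simpa using hη)
    simp only [WeakDual.toStrongDual_apply]
    linarith
  refine ⟨WeakDual.toStrongDual ξ, by simpa using hξ, fun η _ => ?_⟩
  rcases le_or_gt ‖η‖ (c⁻¹ * ‖x‖) with hη | hη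
  · exact hball η hη
  · have hzero := hball 0 (by rw [norm_zero]; positivity)
    have hηx : η x ≤ k η :=
      calc η x ≤ ‖η‖ * ‖x‖ := dual_apply_le_norm_mul_norm η x
        _ ≤ ‖η‖ * (c * ‖η‖) := by gcongr; exact ((inv_mul_lt_iff₀ hc).1 hη).le
        _ = c * ‖η‖ ^ 2 := by ring
        _ ≤ k η := hk η
    simp only [zero_apply] at hzero
    simp only [mem_ofPred_eq]
    linarith

theorem IsLocallyUniformlyConvex.continuous_of_isMaxOn {k : StrongDual ℝ V → ℝ}
    (hk : IsLocallyUniformlyConvex k) {J : V → StrongDual ℝ V}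
    (hJ : ∀ x, IsMaxOn (fun η => η x - k η) univ (J x)) {C : ℝ} (hC : ∀ x, ‖J x‖ ≤ C * ‖x‖) :
    Continuous J := by
  refine continuous_iff_continuousAt.2 fun x => hk.tendsto
    (c := fun z => (C * ‖z‖ + C * ‖x‖) * ‖z - x‖) (fun z => ?_) ?_
  · have hmid : _ ≤ J x x - k (J x) := hJ x (mem_univ ((2⁻¹ : ℝ) • (J x + J z)))
    have hxz : J x z - k (J x) ≤ J z z - k (J z) := hJ z (mem_univ (J x))
    have hpair : (J z - J x) (z - x) ≤ (C * ‖z‖ + C * ‖x‖) * ‖z - x‖ :=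
      (dual_apply_le_norm_mul_norm _ _).trans <| mul_le_mul_of_nonneg_right
        ((norm_sub_le _ _).trans (add_le_add (hC z) (hC x))) (norm_nonneg _)
    simp only [smul_apply, add_apply, sub_apply, smul_eq_mul, map_sub] at hmid hpair
    unfold convexityGap
    linarith
  · have : Continuous fun z => (C * ‖z‖ + C * ‖x‖) * ‖z - x‖ := by fun_prop
    simpa using this.tendsto x

theorem hasFDerivAt_of_convexSubdiff_of_continuousAt {h : V → ℝ} {J : V → StrongDual ℝ V} {x : V}
    (hJ : ∀ z, J z ∈ convexSubdiff h z) (hcont : ContinuousAt J x) : HasFDerivAt h (J x) x := by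
  refine hasFDerivAt_iff_isLittleO.2 (Asymptotics.isLittleO_iff.2 fun ε hε => ?_)
  filter_upwards [hcont (Metric.closedBall_mem_nhds _ hε)] with z hz
  have hlow := hJ x z
  have hup := hJ z x
  have hpair : (J z - J x) (z - x) ≤ ε * ‖z - x‖ :=
    (dual_apply_le_norm_mul_norm _ _).trans <| mul_le_mul_of_nonneg_right
      (by rwa [← dist_eq_norm]) (norm_nonneg _)
  simp only [sub_apply, map_sub] at hlow hup hpair ⊢
  rw [Real.norm_of_nonneg (by linarith)]
  linarith

theorem isSmoothGauge_of_isMaxOn {k : StrongDual ℝ V → ℝ} (hk : IsLocallyUniformlyConvex k)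
    (hk0 : k 0 = 0) (hk_le : ∀ ξ, k ξ ≤ ‖ξ‖ ^ 2 / 4) {J : V → StrongDual ℝ V}
    (hJ : ∀ x, IsMaxOn (fun η => η x - k η) univ (J x)) {C : ℝ} (hC : ∀ x, ‖J x‖ ≤ C * ‖x‖) :
    IsSmoothGauge C fun x => J x x - k (J x) := by
  have hderiv : ∀ x, HasFDerivAt (fun x => J x x - k (J x)) (J x) x := fun x =>
    hasFDerivAt_of_convexSubdiff_of_continuousAt
      (fun z w => by
        have : J z w - k (J z) ≤ J w w - k (J w) := hJ w (mem_univ (J z))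
        rw [map_sub]
        linarith)
      (hk.continuous_of_isMaxOn hJ hC).continuousAt
  refine ⟨?_, fun x => ?_, fun x => (hderiv x).differentiableAt, fun x => ?_⟩
  · have hJ0 : J 0 = 0 := by simpa using hC 0
    simp [hJ0, hk0]
  · obtain ⟨g, hg_norm, hg⟩ := exists_dual_vector'' ℝ x
    have hnorm : ‖(2 * ‖x‖) • g‖ ≤ 2 * ‖x‖ := by
      rw [norm_smul, Real.norm_of_nonneg (by positivity)]
      exact mul_le_of_le_one_right (by positivity) hg_norm
    calc ‖x‖ ^ 2 = 2 * ‖x‖ * g x - (2 * ‖x‖) ^ 2 / 4 := by rw [hg]; simp; ring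
      _ ≤ ((2 * ‖x‖) • g) x - k ((2 * ‖x‖) • g) :=
          sub_le_sub_left ((hk_le _).trans (by gcongr)) _
      _ ≤ J x x - k (J x) := hJ x (mem_univ _)
  · rw [(hderiv x).fderiv]
    exact hC x

theorem IsReflexiveSpace.exists_isSmoothGauge [TopologicalSpace.SeparableSpace V]
    (hV : IsReflexiveSpace V) : ∃ (C : ℝ) (h : V → ℝ), 0 ≤ C ∧ IsSmoothGauge C h := by
  have := hV.separableSpace_dual
  obtain ⟨x, hx, hsep⟩ := exists_seq_unitBall_separating_dual V
  set k := dualEnergy (TopologicalSpace.denseSeq (StrongDual ℝ V)) x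
  have hk0 : k 0 = 0 := le_antisymm (by simpa using dualEnergy_le hx 0)
    (by simpa using le_dualEnergy hx 0)
  choose J hJ_norm hJ using exists_isMaxOn_eval_sub (k := k) (c := 1 / 16)
    (lowerSemicontinuous_dualEnergy hx) hk0.le (by norm_num)
    fun ξ => by simpa [div_eq_inv_mul] using le_dualEnergy hx ξ
  exact ⟨_, _, by norm_num, isSmoothGauge_of_isMaxOn (isLocallyUniformlyConvex_dualEnergy
    (TopologicalSpace.denseRange_denseSeq _) hx hsep) hk0 (dualEnergy_le hx) hJ hJ_norm⟩

end SmoothGauge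

section VariationalPrinciple

variable {Y : Type*}

theorem exists_forall_le_add_of_bddBelow {ψ : Y → ℝ} (hψ : BddBelow (range ψ)) {ε : ℝ}
    (hε : 0 < ε) (u : Y) : ∃ v, ψ v ≤ ψ u ∧ ∀ w, ψ v ≤ ψ w + ε := by
  have : Nonempty Y := ⟨u⟩
  obtain ⟨v, hv⟩ := exists_lt_of_ciInf_lt (lt_add_of_pos_right (⨅ w, ψ w) hε)
  have hinf : ∀ w, ⨅ w, ψ w ≤ ψ w := ciInf_le hψ
  rcases le_total (ψ v) (ψ u) with h | h
  · exact ⟨v, h, fun w => by linarith [hinf w]⟩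
  · exact ⟨u, le_rfl, fun w => by linarith [hinf w]⟩

/-- The `n`-th function of the Borwein–Preiss iteration: `φ` plus the gauges `G · (u j)` centred at
the first `n` points of a sequence, with geometric weights. -/
noncomputable def perturbedSum (φ : Y → ℝ) (G : Y → Y → ℝ) (u : ℕ → Y) (n : ℕ) (w : Y) : ℝ :=
  φ w + ∑ j ∈ Finset.range n, (1 / 2) ^ j * G w (u j)

variable {φ : Y → ℝ} {G : Y → Y → ℝ}

theorem perturbedSum_succ (u : ℕ → Y) (n : ℕ) (w : Y) :
    perturbedSum φ G u (n + 1) w = perturbedSum φ G u n w + (1 / 2) ^ n * G w (u n) := by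
  simp only [perturbedSum, Finset.sum_range_succ]
  ring

theorem perturbedSum_mono (hG : ∀ y z, 0 ≤ G y z) (u : ℕ → Y) (w : Y) :
    Monotone fun n => perturbedSum φ G u n w :=
  monotone_nat_of_le_succ fun n => by
    rw [perturbedSum_succ]
    exact le_add_of_nonneg_right (mul_nonneg (by positivity) (hG _ _))

theorem exists_seq_almost_minimizers (hG : ∀ y z, 0 ≤ G y z) (hG_self : ∀ y, G y y = 0)
    {δ : ℕ → ℝ} (hδ : ∀ n, 0 < δ n) {y₀ : Y} (hy₀ : ∀ z, φ y₀ ≤ φ z + δ 0) :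
    ∃ u : ℕ → Y, u 0 = y₀ ∧
      (∀ n z, perturbedSum φ G u n (u n) ≤ perturbedSum φ G u n z + δ n) ∧
      ∀ n, perturbedSum φ G u (n + 1) (u (n + 1)) ≤ perturbedSum φ G u n (u n) := by
  choose! next hnext_le hnext_min using fun (n : ℕ) (ψ : Y → ℝ) (hψ : BddBelow (range ψ)) =>
    exists_forall_le_add_of_bddBelow hψ (hδ n)
  let step (n : ℕ) (p : (Y → ℝ) × Y) : (Y → ℝ) × Y :=
    (fun w => p.1 w + (1 / 2) ^ n * G w p.2,
      next (n + 1) (fun w => p.1 w + (1 / 2) ^ n * G w p.2) p.2)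
  let state (n : ℕ) : (Y → ℝ) × Y := n.rec (φ, y₀) step
  let u (n : ℕ) : Y := (state n).2
  have hstate : ∀ n, (state n).1 = perturbedSum φ G u n := fun n => by
    induction n with
    | zero => funext w; simp [state, perturbedSum]
    | succ n ih => funext w; rw [perturbedSum_succ, ← ih]
  have hu_succ : ∀ n, u (n + 1) = next (n + 1) (perturbedSum φ G u (n + 1)) (u n) := fun n => by
    rw [← hstate]
  have hbdd : ∀ n, BddBelow (range (perturbedSum φ G u n)) := fun n =>
    ⟨φ y₀ - δ 0, forall_mem_range.2 fun z => by
      have := perturbedSum_mono hG u z n.zero_le (φ := φ)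
      simp only [perturbedSum, Finset.range_zero, Finset.sum_empty, add_zero] at this ⊢
      linarith [hy₀ z]⟩
  refine ⟨u, rfl, fun n z => ?_, fun n => ?_⟩
  · cases n with
    | zero =>
      simp only [perturbedSum, Finset.range_zero, Finset.sum_empty, add_zero]
      exact hy₀ z
    | succ n => rw [hu_succ]; exact hnext_min _ _ (hbdd _) _ z
  · rw [hu_succ]
    refine (hnext_le _ _ (hbdd _) _).trans_eq ?_
    rw [perturbedSum_succ, hG_self, mul_zero, add_zero]

/-- A gauge-type function on a metric space, with quadratic modulus: the perturbations used in the
smooth variational principle. -/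
structure IsGaugeType [PseudoMetricSpace Y] (G : Y → Y → ℝ) : Prop where
  self_eq_zero : ∀ y, G y y = 0
  dist_sq_le : ∀ y z, dist y z ^ 2 ≤ G y z
  continuous : Continuous fun p : Y × Y => G p.1 p.2

section

variable [PseudoMetricSpace Y]

theorem IsGaugeType.nonneg (hG : IsGaugeType G) (y z : Y) : 0 ≤ G y z :=
  (sq_nonneg _).trans (hG.dist_sq_le y z)

theorem dist_succ_le_of_perturbedSum (hG : IsGaugeType G) {u : ℕ → Y} {ρ : ℝ} (hρ : 0 ≤ ρ) {n : ℕ}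
    (hmin : perturbedSum φ G u n (u n) ≤ perturbedSum φ G u n (u (n + 1)) + ρ ^ 2 / 8 ^ n)
    (hle : perturbedSum φ G u (n + 1) (u (n + 1)) ≤ perturbedSum φ G u n (u n)) :
    dist (u n) (u (n + 1)) ≤ 2 * ρ / 2 / 2 ^ n := by
  rw [perturbedSum_succ] at hle
  have hgauge : (1 / 2) ^ n * G (u (n + 1)) (u n) ≤ ρ ^ 2 / 8 ^ n := by linarith
  refine abs_le_of_sq_le_sq' ?_ (by positivity) |>.2
  calc dist (u n) (u (n + 1)) ^ 2 ≤ G (u (n + 1)) (u n) := by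
        rw [dist_comm]; exact hG.dist_sq_le _ _
    _ = 2 ^ n * ((1 / 2) ^ n * G (u (n + 1)) (u n)) := by
        rw [one_div, inv_pow, mul_inv_cancel_left₀ (by positivity)]
    _ ≤ 2 ^ n * (ρ ^ 2 / 8 ^ n) := by gcongr
    _ = (2 * ρ / 2 / 2 ^ n) ^ 2 := by
        rw [show (8 : ℝ) = 2 * 2 * 2 by norm_num, mul_pow, mul_pow]
        field_simp

theorem summable_gauge_of_tendsto (hG : IsGaugeType G) {u : ℕ → Y} {y : Y}
    (hu : Tendsto u atTop (𝓝 y)) (w : Y) : Summable fun j => (1 / 2 : ℝ) ^ j * G w (u j) := by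
  have hlim : Tendsto (fun j => G w (u j)) atTop (𝓝 (G w y)) :=
    (hG.continuous.tendsto (w, y)).comp (tendsto_const_nhds.prodMk_nhds hu)
  obtain ⟨B, hB⟩ := hlim.bddAbove_range
  exact .of_nonneg_of_le (fun j => mul_nonneg (by positivity) (hG.nonneg _ _))
    (fun j => mul_le_mul_of_nonneg_left (hB (mem_range_self j)) (by positivity))
    (summable_geometric_two.mul_right B)

theorem lowerSemicontinuous_perturbedSum (hG : IsGaugeType G) (hφ : LowerSemicontinuous φ)
    (u : ℕ → Y) (n : ℕ) : LowerSemicontinuous (perturbedSum φ G u n) := by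
  refine hφ.add (Continuous.lowerSemicontinuous (continuous_finsetSum _ fun j _ => ?_))
  exact continuous_const.mul (hG.continuous.comp (continuous_id.prodMk continuous_const))

theorem add_tsum_gauge_le_of_tendsto (hG : IsGaugeType G) (hφ : LowerSemicontinuous φ) {u : ℕ → Y}
    {y : Y} (hu : Tendsto u atTop (𝓝 y)) {δ : ℕ → ℝ} (hδ : Tendsto δ atTop (𝓝 0)) {A : ℝ}
    (hA : ∀ n, perturbedSum φ G u n (u n) ≤ A + δ n) :
    φ y + ∑' j, (1 / 2) ^ j * G y (u j) ≤ A := by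
  have hpartial : ∀ n, perturbedSum φ G u n y ≤ A := fun n => by
    have hlim : Tendsto (fun i => (u i, A + δ i)) atTop (𝓝 (y, A)) :=
      hu.prodMk_nhds (by simpa using hδ.const_add A)
    refine (lowerSemicontinuous_iff_isClosed_epigraph.1
      (lowerSemicontinuous_perturbedSum hG hφ u n)).mem_of_tendsto hlim ?_
    filter_upwards [eventually_ge_atTop n] with i hi
    exact (perturbedSum_mono hG.nonneg u (u i) hi).trans (hA i)
  exact le_of_tendsto ((summable_gauge_of_tendsto hG hu y).hasSum.tendsto_sum_nat.const_add (φ y))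
    (.of_forall hpartial)

end

theorem exists_isMinOn_add_tsum_gauge [MetricSpace Y] [CompleteSpace Y] (hG : IsGaugeType G)
    (hφ : LowerSemicontinuous φ) {ρ : ℝ} (hρ : 0 < ρ) {y₀ : Y} (hy₀ : ∀ z, φ y₀ ≤ φ z + ρ ^ 2) :
    ∃ (u : ℕ → Y) (y : Y), dist y₀ y ≤ 2 * ρ ∧ (∀ n, dist (u n) y ≤ 2 * ρ) ∧
      φ y + ∑' j, (1 / 2) ^ j * G y (u j) ≤ φ y₀ ∧
      IsMinOn (fun w => φ w + ∑' j, (1 / 2) ^ j * G w (u j)) univ y := by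
  obtain ⟨u, rfl, hmin, hle⟩ := exists_seq_almost_minimizers hG.nonneg hG.self_eq_zero
    (δ := fun n => ρ ^ 2 / 8 ^ n) (fun n => by positivity) (by simpa using hy₀)
  have hδ : Tendsto (fun n : ℕ => ρ ^ 2 / 8 ^ n) atTop (𝓝 0) :=
    tendsto_const_nhds.div_atTop (tendsto_pow_atTop_atTop_of_one_lt (by norm_num))
  have hdist : ∀ n, dist (u n) (u (n + 1)) ≤ 2 * ρ / 2 / 2 ^ n := fun n =>
    dist_succ_le_of_perturbedSum hG hρ.le (hmin n _) (hle n)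
  obtain ⟨y, hy⟩ := cauchySeq_tendsto_of_complete (cauchySeq_of_le_geometric_two hdist)
  have hdist_lim : ∀ n, dist (u n) y ≤ 2 * ρ := fun n =>
    (dist_le_of_le_geometric_two_of_tendsto hdist hy n).trans
      (div_le_self (by positivity) (one_le_pow₀ one_le_two))
  have hdecr : ∀ n, perturbedSum φ G u n (u n) ≤ φ (u 0) := fun n => by
    simpa [perturbedSum] using
      antitone_nat_of_succ_le (f := fun n => perturbedSum φ G u n (u n)) hle n.zero_le
  refine ⟨u, y, hdist_lim 0, hdist_lim, ?_, fun w _ => ?_⟩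
  · exact add_tsum_gauge_le_of_tendsto hG hφ hy tendsto_const_nhds (by simpa using hdecr)
  · refine add_tsum_gauge_le_of_tendsto hG hφ hy hδ fun n => (hmin n w).trans ?_
    have := (summable_gauge_of_tendsto hG hy w).sum_le_tsum (Finset.range n)
      fun j _ => mul_nonneg (by positivity) (hG.nonneg _ _)
    simp only [perturbedSum]
    linarith

end VariationalPrinciple

section GaugeSum

variable {V : Type*} [NormedAddCommGroup V] [NormedSpace ℝ V] {C : ℝ} {h : V → ℝ}

namespace IsSmoothGauge

theorem continuous (hh : IsSmoothGauge C h) : Continuous h :=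
  hh.differentiable.continuous

theorem nonneg (hh : IsSmoothGauge C h) (x : V) : 0 ≤ h x :=
  (sq_nonneg _).trans (hh.norm_sq_le x)

theorem le_mul_norm_sq (hh : IsSmoothGauge C h) (hC : 0 ≤ C) (x : V) : h x ≤ C * ‖x‖ ^ 2 := by
  have hmvt : ‖h x - h 0‖ ≤ C * ‖x‖ * ‖x - 0‖ :=
    (convex_closedBall (0 : V) ‖x‖).norm_image_sub_le_of_norm_fderiv_le
      (fun z _ => hh.differentiable z)
      (fun z hz => (hh.norm_fderiv_le z).trans <| by
        rw [mem_closedBall_zero_iff] at hz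
        gcongr)
      (by simp) (by simp)
  calc h x ≤ ‖h x - h 0‖ := by rw [hh.map_zero, sub_zero]; exact Real.le_norm_self _
    _ ≤ C * ‖x‖ * ‖x - 0‖ := hmvt
    _ = C * ‖x‖ ^ 2 := by rw [sub_zero]; ring

theorem isGaugeType_prod (hh : IsSmoothGauge C h) {Y : Type*} [PseudoMetricSpace Y] {f : Y → V}
    (hf : Isometry f) :
    IsGaugeType fun p q : Y × V => h (f p.1 - f q.1) + h (p.2 - q.2) where
  self_eq_zero p := by simp only [sub_self, hh.map_zero, add_zero]
  dist_sq_le p q := by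
    have h₁ := hh.norm_sq_le (f p.1 - f q.1)
    have h₂ := hh.norm_sq_le (p.2 - q.2)
    rw [← dist_eq_norm, hf.dist_eq] at h₁
    rw [← dist_eq_norm] at h₂
    rw [Prod.dist_eq]
    rcases max_cases (dist p.1 q.1) (dist p.2 q.2) with ⟨hmax, -⟩ | ⟨hmax, -⟩ <;> rw [hmax]
    · linarith [hh.nonneg (p.2 - q.2)]
    · linarith [hh.nonneg (f p.1 - f q.1)]
  continuous := by
    have := hh.continuous
    have := hf.continuous
    fun_prop

end IsSmoothGauge

/-- The perturbation produced by the smooth variational principle: a geometrically weighted sum of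
translates of `h`. -/
noncomputable def gaugeSum (h : V → ℝ) (u : ℕ → V) (w : V) : ℝ :=
  ∑' j, (1 / 2) ^ j * h (w - u j)

namespace IsSmoothGauge

variable {u : ℕ → V} {y : V} {R : ℝ}

theorem gaugeSum_nonneg (hh : IsSmoothGauge C h) (u : ℕ → V) (w : V) : 0 ≤ gaugeSum h u w :=
  tsum_nonneg fun _ => mul_nonneg (by positivity) (hh.nonneg _)

theorem summable_gaugeSum (hh : IsSmoothGauge C h) (hC : 0 ≤ C) (hu : ∀ j, dist (u j) y ≤ R)
    (w : V) : Summable fun j => (1 / 2 : ℝ) ^ j * h (w - u j) := by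
  refine .of_nonneg_of_le (fun j => mul_nonneg (by positivity) (hh.nonneg _)) (fun j => ?_)
    (summable_geometric_two.mul_right (C * (dist w y + R) ^ 2))
  refine mul_le_mul_of_nonneg_left ((hh.le_mul_norm_sq hC _).trans ?_) (by positivity)
  have hdist : ‖w - u j‖ ≤ dist w y + R := by
    rw [← dist_eq_norm]
    exact (dist_triangle_right w (u j) y).trans (add_le_add_right (hu j) _)
  gcongr

theorem exists_hasFDerivAt_gaugeSum (hh : IsSmoothGauge C h) (hC : 0 ≤ C)
    (hu : ∀ j, dist (u j) y ≤ R) :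
    ∃ Λ : StrongDual ℝ V, HasFDerivAt (gaugeSum h u) Λ y ∧ ‖Λ‖ ≤ 2 * (C * R) := by
  have hterm : ∀ j w, HasFDerivAt (fun w => (1 / 2 : ℝ) ^ j * h (w - u j))
      ((1 / 2 : ℝ) ^ j • fderiv ℝ h (w - u j)) w := fun j w =>
    ((hh.differentiable (w - u j)).hasFDerivAt.comp w
      ((hasFDerivAt_id w).sub_const (u j))).const_mul _
  have hbound : ∀ j w, ‖(1 / 2 : ℝ) ^ j • fderiv ℝ h (w - u j)‖ ≤
      (1 / 2) ^ j * (C * (dist w y + R)) := fun j w => by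
    rw [norm_smul, Real.norm_of_nonneg (by positivity)]
    refine mul_le_mul_of_nonneg_left ((hh.norm_fderiv_le _).trans ?_) (by positivity)
    rw [← dist_eq_norm]
    exact mul_le_mul_of_nonneg_left
      ((dist_triangle_right w (u j) y).trans (add_le_add_right (hu j) _)) hC
  refine ⟨∑' j, (1 / 2 : ℝ) ^ j • fderiv ℝ h (y - u j), ?_, ?_⟩
  · refine hasFDerivAt_tsum_of_isPreconnected (s := Metric.ball y 1)
      (u := fun j => (1 / 2) ^ j * (C * (1 + R))) (summable_geometric_two.mul_right _)
      Metric.isOpen_ball (convex_ball y 1).isPreconnected (fun j w _ => hterm j w)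
      (fun j w hw => (hbound j w).trans ?_) (Metric.mem_ball_self one_pos)
      (hh.summable_gaugeSum hC hu y) (Metric.mem_ball_self one_pos)
    have : dist w y ≤ 1 := (Metric.mem_ball.1 hw).le
    gcongr
  · refine tsum_of_norm_bounded (hasSum_geometric_two.mul_right (C * R)) fun j => ?_
    simpa only [dist_self, zero_add] using hbound j y

end IsSmoothGauge

end GaugeSum

section Subdifferentials

variable {V : Type*} [NormedAddCommGroup V] [NormedSpace ℝ V] {f g : V → ℝ} {u : V}
  {ξ η : StrongDual ℝ V}

theorem mem_frechetSubdiff_coe : ξ ∈ frechetSubdiff (fun v => (f v : EReal)) u ↔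
    ∀ ε : ℝ, 0 < ε → ∀ᶠ v in 𝓝 u, f u + (ξ (v - u) - ε * ‖v - u‖) ≤ f v := by
  simp only [frechetSubdiff, mem_ofPred_eq, ne_eq, EReal.coe_ne_top, EReal.coe_ne_bot,
    not_false_eq_true, true_and, ← EReal.coe_add, EReal.coe_le_coe_iff]

theorem neg_mem_frechetSubdiff_of_isLocalMin {ψ : V → ℝ} {ψ' : StrongDual ℝ V}
    (hψ : HasFDerivAt ψ ψ' u) (hmin : IsLocalMin (fun v => f v + ψ v) u) :
    -ψ' ∈ frechetSubdiff (fun v => (f v : EReal)) u := by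
  refine mem_frechetSubdiff_coe.2 fun ε hε => ?_
  filter_upwards [hmin, hψ.isLittleO.bound hε] with v hv hψv
  rw [neg_apply]
  linarith [(Real.le_norm_self _).trans hψv]

theorem frechetSubdiff_subset_convexSubdiff (hg : ConvexOn ℝ univ g) (u : V) :
    frechetSubdiff (fun v => (g v : EReal)) u ⊆ convexSubdiff g u := by
  intro η hη z
  have hglobal : ∀ ε : ℝ, 0 < ε → g u + η (z - u) ≤ g z + ε * ‖z - u‖ := fun ε hε => by
    have hconv : ConvexOn ℝ univ fun v => g v + (-η) v + ε * dist v u :=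
      (hg.add ((-η).toLinearMap.convexOn convex_univ)).add
        ((convexOn_univ_dist u).smul hε.le)
    have hloc : IsLocalMin (fun v => g v + (-η) v + ε * dist v u) u := by
      filter_upwards [mem_frechetSubdiff_coe.1 hη ε hε] with v hv
      rw [map_sub] at hv
      simp only [neg_apply, dist_self, dist_eq_norm v u]
      linarith
    have := IsMinOn.of_isLocalMin_of_convex_univ hloc hconv z
    simp only [neg_apply, dist_self, dist_eq_norm z u] at this
    rw [map_sub]
    linarith
  have hlim : Tendsto (fun ε : ℝ => g z + ε * ‖z - u‖) (𝓝[>] 0) (𝓝 (g z)) := by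
    have : Continuous fun ε : ℝ => g z + ε * ‖z - u‖ := by fun_prop
    simpa using (this.tendsto 0).mono_left nhdsWithin_le_nhds
  exact ge_of_tendsto hlim (eventually_mem_nhdsWithin.mono hglobal)

theorem locallyLipschitz_of_convexOn_of_lowerSemicontinuous [CompleteSpace V]
    (hg : ConvexOn ℝ univ g) (hg_lsc : LowerSemicontinuous g) : LocallyLipschitz g := by
  obtain ⟨n, y, hy⟩ := nonempty_interior_of_iUnion_of_closed
    (f := fun n : ℕ => g ⁻¹' Iic (n : ℝ)) (fun n => hg_lsc.isClosed_preimage _)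
    (eq_univ_of_forall fun v => mem_iUnion.2 (exists_nat_ge (g v)))
  have hbdd : ∃ y ∈ (univ : Set V), (𝓝 y).IsBoundedUnder (· ≤ ·) g :=
    ⟨y, mem_univ y, n, mem_interior_iff_mem_nhds.1 hy⟩
  exact locallyLipschitzOn_univ.1
    (((hg.continuousOn_tfae isOpen_univ univ_nonempty).out 3 0).1 hbdd)

theorem exists_eventually_le_add_mul_norm_sub (hg : ConvexOn ℝ univ g)
    (hg_lip : LocallyLipschitz g) (x : V) :
    ∃ L, 0 ≤ L ∧ ∀ᶠ u in 𝓝 x, ∀ v, g u ≤ g v + L * ‖u - v‖ := by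
  obtain ⟨L, s, hs, hL⟩ := hg_lip x
  refine ⟨L, L.2, ?_⟩
  filter_upwards [eventually_mem_nhds_iff.2 hs] with u hu v
  have hconv : ConvexOn ℝ univ fun v => g v + L * dist v u :=
    hg.add ((convexOn_univ_dist u).smul L.2)
  have hloc : IsLocalMin (fun v => g v + L * dist v u) u := by
    filter_upwards [hu] with v hv
    have := (Real.le_norm_self _).trans (hL.dist_le_mul u (mem_of_mem_nhds hu) v hv)
    rw [dist_self, dist_comm]
    linarith
  have := IsMinOn.of_isLocalMin_of_convex_univ hloc hconv v
  rwa [dist_self, mul_zero, add_zero, dist_comm, dist_eq_norm] at this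

theorem norm_le_of_mem_convexSubdiff {L : ℝ} (hL : 0 ≤ L)
    (hu : ∀ᶠ v in 𝓝 u, g v ≤ g u + L * ‖v - u‖) (hη : η ∈ convexSubdiff g u) : ‖η‖ ≤ L := by
  have hle : ∀ᶠ z in 𝓝 (0 : V), η z ≤ L * ‖z‖ := by
    have hshift : Tendsto (fun z => u + z) (𝓝 0) (𝓝 u) := by
      simpa using (continuous_const_add u).tendsto 0
    filter_upwards [hshift.eventually hu] with z hz
    have := hη (u + z)
    rw [add_sub_cancel_left] at this hz
    linarith
  have hneg : Tendsto (fun z : V => -z) (𝓝 0) (𝓝 0) := by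
    simpa using (continuous_neg (G := V)).tendsto 0
  refine ContinuousLinearMap.opNorm_le_of_nhds_zero hL ?_
  filter_upwards [hle, hneg.eventually hle] with z hz hz_neg
  rw [map_neg, norm_neg] at hz_neg
  exact abs_le'.2 ⟨hz, hz_neg⟩

end Subdifferentials

section ApproximateSumRule

variable {V : Type*} [NormedAddCommGroup V] [NormedSpace ℝ V] {C L N r ρ : ℝ} {f g h : V → ℝ}
  {x : V}

theorem IsSmoothGauge.le_add_penalty (hh : IsSmoothGauge C h) (hN : 0 ≤ N)
    (hNL : L ^ 2 ≤ 4 * (N * ρ ^ 2)) {u : V} (hu : ∀ v, g u ≤ g v + L * ‖u - v‖)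
    (v : V) : g u ≤ g v + N * h (u - v) + ρ ^ 2 := by
  set d := ‖u - v‖
  have hsq : (L * d) ^ 2 ≤ (N * d ^ 2 + ρ ^ 2) ^ 2 := by
    have := mul_le_mul_of_nonneg_right hNL (sq_nonneg d)
    linarith [sq_nonneg (N * d ^ 2 - ρ ^ 2)]
  have hyoung : L * d ≤ N * d ^ 2 + ρ ^ 2 := (abs_le_of_sq_le_sq' hsq (by positivity)).2
  have hgauge : N * d ^ 2 ≤ N * h (u - v) := mul_le_mul_of_nonneg_left (hh.norm_sq_le _) hN
  linarith [hu v]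

theorem IsSmoothGauge.exists_isMinOn_decoupled [CompleteSpace V] (hh : IsSmoothGauge C h)
    (hC : 0 ≤ C) (hf : LowerSemicontinuous f) (hg : Continuous g) (hr : 0 ≤ r)
    (hmin : ∀ u ∈ Metric.closedBall x r, f x + g x ≤ f u + g u)
    (hL : ∀ u ∈ Metric.closedBall x r, ∀ v, g u ≤ g v + L * ‖u - v‖)
    (hN : 0 ≤ N) (hρ : 0 < ρ) (hNL : L ^ 2 ≤ 4 * (N * ρ ^ 2)) :
    ∃ (us vs : ℕ → V) (u v : V), dist x u ≤ 2 * ρ ∧ dist x v ≤ 2 * ρ ∧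
      (∀ j, dist (us j) u ≤ 2 * ρ) ∧ (∀ j, dist (vs j) v ≤ 2 * ρ) ∧ f u + g v ≤ f x + g x ∧
      IsMinOn (fun p : V × V => f p.1 + g p.2 + N * h (p.1 - p.2) +
        (gaugeSum h us p.1 + gaugeSum h vs p.2)) (Metric.closedBall x r ×ˢ univ) (u, v) := by
  have : CompleteSpace (Metric.closedBall x r) := Metric.isClosed_closedBall.completeSpace_coe
  let φ (p : Metric.closedBall x r × V) : ℝ := f p.1 + g p.2 + N * h (p.1 - p.2)
  have hφ : LowerSemicontinuous φ := by
    have hcont : Continuous fun p : Metric.closedBall x r × V => g p.2 + N * h (p.1 - p.2) := by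
      have := hh.continuous
      fun_prop
    simp only [φ, add_assoc]
    exact (hf.comp (continuous_subtype_val.comp continuous_fst)).add hcont.lowerSemicontinuous
  let y₀ : Metric.closedBall x r × V := (⟨x, Metric.mem_closedBall_self hr⟩, x)
  have hφ_y₀ : φ y₀ = f x + g x := by simp [φ, y₀, hh.map_zero]
  have halmost : ∀ p, φ y₀ ≤ φ p + ρ ^ 2 := fun ⟨u, v⟩ => by
    rw [hφ_y₀]
    have := hh.le_add_penalty hN hNL (hL u u.2) v
    simp only [φ]
    linarith [hmin u u.2]
  obtain ⟨w, ⟨⟨u, hu⟩, v⟩, hy₀, hw, hval, hmin_y⟩ := exists_isMinOn_add_tsum_gauge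
    (hh.isGaugeType_prod isometry_subtype_coe) hφ hρ halmost
  simp only [Prod.dist_eq, max_le_iff, Subtype.dist_eq] at hy₀ hw
  have hsum : ∀ u v : V, ∑' j, (1 / 2) ^ j * (h (u - (w j).1) + h (v - (w j).2)) =
      gaugeSum h (fun j => (w j).1) u + gaugeSum h (fun j => (w j).2) v := fun u v => by
    simp only [mul_add]
    exact (hh.summable_gaugeSum hC (fun j => (hw j).1) _).tsum_add
      (hh.summable_gaugeSum hC (fun j => (hw j).2) _)
  simp only [hsum] at hval hmin_y
  refine ⟨_, _, u, v, hy₀.1, hy₀.2, fun j => (hw j).1, fun j => (hw j).2, ?_, ?_⟩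
  · have h₁ := hh.gaugeSum_nonneg (fun j => (w j).1) u
    have h₂ := hh.gaugeSum_nonneg (fun j => (w j).2) v
    have h₃ := mul_nonneg hN (hh.nonneg (u - v))
    simp only [hφ_y₀, φ] at hval
    linarith
  · rintro ⟨u', v'⟩ ⟨hu', -⟩
    exact hmin_y (mem_univ (⟨u', hu'⟩, v'))

theorem IsSmoothGauge.exists_approx_subgradients_of_lipschitz [CompleteSpace V]
    (hh : IsSmoothGauge C h) (hC : 0 ≤ C) (hf : LowerSemicontinuous f) (hg : Continuous g)
    (hg_conv : ConvexOn ℝ univ g)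
    (hmin : ∀ u ∈ Metric.closedBall x r, f x + g x ≤ f u + g u)
    (hL : ∀ u ∈ Metric.closedBall x r, ∀ v, g u ≤ g v + L * ‖u - v‖)
    (hρ : 0 < ρ) (hρr : 2 * ρ < r) :
    ∃ (u v : V) (ξ η : StrongDual ℝ V), dist x u ≤ 2 * ρ ∧ dist x v ≤ 2 * ρ ∧
      ξ ∈ frechetSubdiff (fun w => (f w : EReal)) u ∧ η ∈ convexSubdiff g v ∧
      ‖ξ + η‖ ≤ 8 * C * ρ ∧ f u + g v ≤ f x + g x := by
  obtain ⟨us, vs, u, v, hu, hv, hus, hvs, hval, hmin_uv⟩ := hh.exists_isMinOn_decoupled hC hf hg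
    (by linarith) hmin hL (N := L ^ 2 / (4 * ρ ^ 2)) (by positivity) hρ (by field_simp; rfl)
  set N := L ^ 2 / (4 * ρ ^ 2)
  set J := fderiv ℝ h (u - v)
  have hJ : HasFDerivAt h J (u - v) := (hh.differentiable (u - v)).hasFDerivAt
  obtain ⟨Λ₁, hΛ₁, hΛ₁_norm⟩ := hh.exists_hasFDerivAt_gaugeSum hC hus
  obtain ⟨Λ₂, hΛ₂, hΛ₂_norm⟩ := hh.exists_hasFDerivAt_gaugeSum hC hvs
  have hpen_u : HasFDerivAt (fun w => N * h (w - v) + gaugeSum h us w) (N • J + Λ₁) u :=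
    ((hJ.comp u ((hasFDerivAt_id u).sub_const v)).const_mul N).add hΛ₁
  have hpen_v : HasFDerivAt (fun w => N * h (u - w) + gaugeSum h vs w) (-(N • J) + Λ₂) v := by
    have hcomp : J.comp (-ContinuousLinearMap.id ℝ V) = -J := by ext; simp
    have := ((hJ.comp v ((hasFDerivAt_id v).const_sub u)).const_mul N).add hΛ₂
    rwa [hcomp, smul_neg] at this
  refine ⟨u, v, -(N • J + Λ₁), -(-(N • J) + Λ₂), hu, hv,
    neg_mem_frechetSubdiff_of_isLocalMin hpen_u ?_,
    frechetSubdiff_subset_convexSubdiff hg_conv v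
      (neg_mem_frechetSubdiff_of_isLocalMin hpen_v ?_), ?_, hval⟩
  · have hball : Metric.closedBall x r ∈ 𝓝 u :=
      Metric.closedBall_mem_nhds_of_mem (by rw [Metric.mem_ball']; linarith)
    filter_upwards [hball] with w hw
    have := isMinOn_iff.1 hmin_uv (w, v) (mk_mem_prod hw (mem_univ v))
    simp only at this
    linarith
  · refine .of_forall fun w => ?_
    have := isMinOn_iff.1 hmin_uv (u, w)
      (mk_mem_prod (Metric.mem_closedBall'.2 (by linarith)) (mem_univ w))
    simp only at this
    linarith
  · calc ‖-(N • J + Λ₁) + -(-(N • J) + Λ₂)‖ = ‖Λ₁ + Λ₂‖ := by rw [← norm_neg]; congr 1; abel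
      _ ≤ ‖Λ₁‖ + ‖Λ₂‖ := norm_add_le _ _
      _ ≤ 8 * C * ρ := by linarith

end ApproximateSumRule

section LimitingSumRule

variable {V : Type*} [NormedAddCommGroup V] [NormedSpace ℝ V] {g : V → ℝ} {x : V}

/-- The limiting (Mordukhovich) subdifferential: weak limits of Fréchet subgradients along sequences
that converge strongly together with their values. -/
def limitingSubdiff (f : V → EReal) (x : V) : Set (StrongDual ℝ V) :=
  {ξ | ∃ (us : ℕ → V) (ξs : ℕ → StrongDual ℝ V), (∀ n, ξs n ∈ frechetSubdiff f (us n)) ∧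
    Tendsto us atTop (𝓝 x) ∧ Tendsto (fun n => f (us n)) atTop (𝓝 (f x)) ∧
    Tendsto (fun n => toWeakSpace ℝ (StrongDual ℝ V) (ξs n)) atTop
      (𝓝 (toWeakSpace ℝ (StrongDual ℝ V) ξ))}

theorem IsReflexiveSpace.exists_seq_approx_subgradients [CompleteSpace V]
    [TopologicalSpace.SeparableSpace V] (hV : IsReflexiveSpace V) {f : V → ℝ}
    (hf : LowerSemicontinuous f) (hg : ConvexOn ℝ univ g) (hg_lip : LocallyLipschitz g)
    (hmin : IsLocalMin (fun u => f u + g u) x) :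
    ∃ (us vs : ℕ → V) (ξs ηs : ℕ → StrongDual ℝ V),
      (∀ n, ξs n ∈ frechetSubdiff (fun u => (f u : EReal)) (us n)) ∧
      (∀ n, ηs n ∈ convexSubdiff g (vs n)) ∧ (∀ n, f (us n) + g (vs n) ≤ f x + g x) ∧
      Tendsto us atTop (𝓝 x) ∧ Tendsto vs atTop (𝓝 x) ∧ Tendsto (ξs + ηs) atTop (𝓝 0) := by
  obtain ⟨C, h, hC, hh⟩ := hV.exists_isSmoothGauge
  obtain ⟨L, -, hL⟩ := exists_eventually_le_add_mul_norm_sub hg hg_lip x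
  obtain ⟨r, hr, hball⟩ := Metric.nhds_basis_closedBall.eventually_iff.1 (hmin.and hL)
  obtain ⟨ρ, -, hρ, hρ_lim⟩ := exists_seq_strictAnti_tendsto' (half_pos hr)
  choose us vs ξs ηs hus hvs hξs hηs hsum hval using fun n =>
    hh.exists_approx_subgradients_of_lipschitz hC hf hg_lip.continuous hg
      (fun u hu => (hball hu).1) (fun u hu => (hball hu).2) (hρ n).1
      (by linarith [(hρ n).2])
  have hρ_two : Tendsto (fun n => 2 * ρ n) atTop (𝓝 0) := by simpa using hρ_lim.const_mul 2
  simp only [dist_comm x] at hus hvs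
  exact ⟨us, vs, ξs, ηs, hξs, hηs, hval,
    tendsto_iff_dist_tendsto_zero.2 (squeeze_zero (fun _ => dist_nonneg) hus hρ_two),
    tendsto_iff_dist_tendsto_zero.2 (squeeze_zero (fun _ => dist_nonneg) hvs hρ_two),
    squeeze_zero_norm hsum (by simpa using hρ_lim.const_mul (8 * C))⟩

theorem exists_eventually_norm_le_of_mem_convexSubdiff (hg : ConvexOn ℝ univ g)
    (hg_lip : LocallyLipschitz g) (x : V) :
    ∃ L, ∀ᶠ u in 𝓝 x, ∀ η ∈ convexSubdiff g u, ‖η‖ ≤ L := by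
  obtain ⟨L, hL0, hL⟩ := exists_eventually_le_add_mul_norm_sub hg hg_lip x
  refine ⟨L, ?_⟩
  filter_upwards [eventually_eventually_nhds.2 hL] with u hu η hη
  exact norm_le_of_mem_convexSubdiff hL0 (hu.mono fun v hv => hv u) hη

theorem mem_convexSubdiff_of_tendsto (hg : Continuous g) {vs : ℕ → V} {ηs : ℕ → StrongDual ℝ V}
    {η : StrongDual ℝ V} {L : ℝ} (hηs : ∀ n, ηs n ∈ convexSubdiff g (vs n))
    (hL : ∀ᶠ n in atTop, ‖ηs n‖ ≤ L) (hvs : Tendsto vs atTop (𝓝 x))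
    (hη : ∀ z, Tendsto (fun n => ηs n z) atTop (𝓝 (η z))) : η ∈ convexSubdiff g x := by
  intro z
  have hsmall : Tendsto (fun n => ηs n (vs n - x)) atTop (𝓝 0) := by
    have hbound : Tendsto (fun n => L * ‖vs n - x‖) atTop (𝓝 0) := by
      simpa using (tendsto_iff_norm_sub_tendsto_zero.1 hvs).const_mul L
    refine squeeze_zero_norm' ?_ hbound
    filter_upwards [hL] with n hn
    exact (ηs n).le_of_opNorm_le hn _
  have hlim := ((hg.tendsto x).comp hvs).add ((hη (z - x)).sub hsmall)
  rw [sub_zero] at hlim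
  refine le_of_tendsto hlim (.of_forall fun n => ?_)
  have := hηs n z
  simp only [map_sub, Function.comp_apply] at this ⊢
  linarith

theorem tendsto_of_add_le_of_lowerSemicontinuousAt {X : Type*} [TopologicalSpace X] {f g : X → ℝ}
    {x : X} (hf : LowerSemicontinuousAt f x) (hg : ContinuousAt g x) {us vs : ℕ → X}
    (hus : Tendsto us atTop (𝓝 x)) (hvs : Tendsto vs atTop (𝓝 x))
    (hle : ∀ n, f (us n) + g (vs n) ≤ f x + g x) :
    Tendsto (fun n => f (us n)) atTop (𝓝 (f x)) := by
  have hupper : Tendsto (fun n => f x + g x - g (vs n)) atTop (𝓝 (f x)) := by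
    simpa using (hg.tendsto.comp hvs).const_sub (f x + g x)
  refine tendsto_order.2 ⟨fun b hb => hus.eventually (hf b hb), fun b hb => ?_⟩
  filter_upwards [hupper.eventually_lt_const hb] with n hn
  linarith [hle n]

theorem exists_subseq_tendsto_apply [TopologicalSpace.SeparableSpace V]
    {ξs : ℕ → StrongDual ℝ V} {R : ℝ} (hR : ∀ᶠ n in atTop, ‖ξs n‖ ≤ R) :
    ∃ (ξ : StrongDual ℝ V) (k : ℕ → ℕ), StrictMono k ∧
      ∀ v, Tendsto (fun n => ξs (k n) v) atTop (𝓝 (ξ v)) := by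
  obtain ⟨ξ, -, k, hk, hlim⟩ := (WeakDual.isSeqCompact_closedBall ℝ V 0 R).subseq_of_frequently_in
    (x := fun n => StrongDual.toWeakDual (ξs n)) (hR.mono fun n hn => by simpa using hn).frequently
  exact ⟨WeakDual.toStrongDual ξ, k, hk, fun v =>
    ((WeakDual.eval_continuous v).tendsto ξ).comp hlim⟩

theorem IsReflexiveSpace.tendsto_toWeakSpace (hV : IsReflexiveSpace V)
    {ξs : ℕ → StrongDual ℝ V} {ξ : StrongDual ℝ V}
    (hξ : ∀ v, Tendsto (fun n => ξs n v) atTop (𝓝 (ξ v))) :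
    Tendsto (fun n => toWeakSpace ℝ (StrongDual ℝ V) (ξs n)) atTop
      (𝓝 (toWeakSpace ℝ (StrongDual ℝ V) ξ)) := by
  have hinj : Function.Injective (topDualPairing ℝ (StrongDual ℝ V)).flip := fun ξ₁ ξ₂ heq => by
    ext v
    exact congrArg (fun B => B (NormedSpace.inclusionInDoubleDual ℝ V v)) heq
  refine (WeakBilin.tendsto_iff_forall_eval_tendsto _ hinj).2 fun Φ => ?_
  obtain ⟨v, rfl⟩ := hV Φ
  exact hξ v

theorem IsReflexiveSpace.exists_mem_limitingSubdiff_coe [CompleteSpace V]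
    [TopologicalSpace.SeparableSpace V] (hV : IsReflexiveSpace V) {f : V → ℝ}
    (hf : LowerSemicontinuous f) (hg : ConvexOn ℝ univ g) (hg_lip : LocallyLipschitz g)
    (hmin : IsLocalMin (fun u => f u + g u) x) :
    ∃ ξ ∈ limitingSubdiff (fun u => (f u : EReal)) x, -ξ ∈ convexSubdiff g x := by
  obtain ⟨us, vs, ξs, ηs, hξs, hηs, hval, hus, hvs, hsum⟩ :=
    hV.exists_seq_approx_subgradients hf hg hg_lip hmin
  obtain ⟨L, hL⟩ := exists_eventually_norm_le_of_mem_convexSubdiff hg hg_lip x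
  have hηs_le : ∀ᶠ n in atTop, ‖ηs n‖ ≤ L := (hvs.eventually hL).mono fun n hn => hn _ (hηs n)
  obtain ⟨η, k, hk, hη⟩ := exists_subseq_tendsto_apply hηs_le
  have hk_lim := hk.tendsto_atTop
  have hξ : ∀ v, Tendsto (fun n => ξs (k n) v) atTop (𝓝 ((-η) v)) := fun v => by
    have hsum_v : Tendsto (fun n => (ξs (k n) + ηs (k n)) v) atTop (𝓝 0) := by
      have := ((ContinuousLinearMap.apply ℝ ℝ v).continuous.tendsto 0).comp (hsum.comp hk_lim)
      rwa [map_zero] at this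
    simpa using hsum_v.sub (hη v)
  refine ⟨-η, ⟨us ∘ k, ξs ∘ k, fun n => hξs _, hus.comp hk_lim, ?_, hV.tendsto_toWeakSpace hξ⟩, ?_⟩
  · exact (continuous_coe_real_ereal.tendsto _).comp
      ((tendsto_of_add_le_of_lowerSemicontinuousAt (hf x) hg_lip.continuous.continuousAt hus hvs
        hval).comp hk_lim)
  · rw [neg_neg]
    exact mem_convexSubdiff_of_tendsto hg_lip.continuous (fun n => hηs (k n))
      (hk_lim.eventually hηs_le) (hvs.comp hk_lim) hη

end LimitingSumRule

section ExtendedReal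

variable {V : Type*} [NormedAddCommGroup V] [NormedSpace ℝ V] {f : V → EReal} {g : V → ℝ}
  {M : EReal} {x : V}

theorem lowerSemicontinuous_toReal {X : Type*} [TopologicalSpace X] {f : X → EReal}
    (hf : LowerSemicontinuous f) (hbot : ∀ u, f u ≠ ⊥) (htop : ∀ u, f u ≠ ⊤) :
    LowerSemicontinuous fun u => (f u).toReal := by
  intro u b hb
  have hlt : (b : EReal) < f u := by
    rwa [← EReal.coe_toReal (htop u) (hbot u), EReal.coe_lt_coe_iff]
  filter_upwards [hf u b hlt] with v hv
  rw [← EReal.coe_toReal (htop v) (hbot v)] at hv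
  exact EReal.coe_lt_coe_iff.1 hv

theorem coe_toReal_inf_coe {b : EReal} (hb : b ≠ ⊥) (c : ℝ) :
    (((b ⊓ (c : EReal)).toReal : ℝ) : EReal) = b ⊓ (c : EReal) :=
  EReal.coe_toReal (ne_top_of_le_ne_top (EReal.coe_ne_top c) inf_le_right)
    fun h => (min_eq_bot.1 h).elim hb (EReal.coe_ne_bot c)

theorem frechetSubdiff_inf_subset {u : V} (hu : f u < M) :
    frechetSubdiff (fun v => f v ⊓ M) u ⊆ frechetSubdiff f u := by
  rintro ξ ⟨htop, hbot, hξ⟩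
  simp only [inf_of_le_left hu.le] at htop hbot hξ
  exact ⟨htop, hbot, fun ε hε => (hξ ε hε).mono fun v hv => hv.trans inf_le_left⟩

theorem limitingSubdiff_inf_subset (hx : f x < M) :
    limitingSubdiff (fun v => f v ⊓ M) x ⊆ limitingSubdiff f x := by
  rintro ξ ⟨us, ξs, hξs, hus, hfus, hξ⟩
  simp only [inf_of_le_left hx.le] at hfus
  obtain ⟨N, hN⟩ := eventually_atTop.1 (hfus.eventually_lt_const hx)
  have hlt : ∀ n, f (us (n + N)) < M := fun n => by
    simpa using hN (n + N) (Nat.le_add_left N n)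
  have hshift := tendsto_add_atTop_nat N
  refine ⟨fun n => us (n + N), fun n => ξs (n + N),
    fun n => frechetSubdiff_inf_subset (hlt n) (hξs _), hus.comp hshift, ?_, hξ.comp hshift⟩
  exact (hfus.comp hshift).congr fun n => inf_of_le_left (hlt n).le

theorem isLocalMin_toReal_inf_add {X : Type*} [TopologicalSpace X] {f : X → EReal} {g : X → ℝ}
    {x : X} (hbot : ∀ u, f u ≠ ⊥) (hg : ContinuousAt g x) {c : ℝ} (hx : f x < c)
    (hmin : IsLocalMin (fun u => f u + (g u : EReal)) x) :
    IsLocalMin (fun u => (f u ⊓ (c : EReal)).toReal + g u) x := by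
  obtain ⟨a, ha⟩ : ∃ a : ℝ, f x = a := ⟨_, (EReal.coe_toReal hx.ne_top (hbot x)).symm⟩
  have hac : a < c := by rwa [ha, EReal.coe_lt_coe_iff] at hx
  have hg_gt : ∀ᶠ u in 𝓝 x, g x - (c - a) < g u :=
    hg.eventually_const_lt (sub_lt_self _ (sub_pos.2 hac))
  filter_upwards [hmin, hg_gt] with u hu hgu
  rw [← EReal.coe_le_coe_iff, EReal.coe_add, EReal.coe_add, coe_toReal_inf_coe (hbot u),
    coe_toReal_inf_coe (hbot x), inf_of_le_left hx.le]
  rcases le_total (f u) c with hfu | hfu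
  · rwa [inf_of_le_left hfu]
  · rw [inf_of_le_right hfu, ha]
    exact_mod_cast (by linarith : a + g x ≤ c + g u)

theorem IsReflexiveSpace.exists_mem_limitingSubdiff [CompleteSpace V]
    [TopologicalSpace.SeparableSpace V] (hV : IsReflexiveSpace V)
    (hf : LowerSemicontinuous f) (hbot : ∀ u, f u ≠ ⊥) (hx : f x ≠ ⊤) (hg : ConvexOn ℝ univ g)
    (hg_lsc : LowerSemicontinuous g) (hmin : IsLocalMin (fun u => f u + (g u : EReal)) x) :
    ∃ ξ ∈ limitingSubdiff f x, -ξ ∈ convexSubdiff g x := by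
  have hg_lip := locallyLipschitz_of_convexOn_of_lowerSemicontinuous hg hg_lsc
  obtain ⟨c, hxc⟩ : ∃ c : ℝ, f x < c := by
    obtain ⟨c, hc, -⟩ := EReal.lt_iff_exists_real_btwn.1 hx.lt_top
    exact ⟨c, hc⟩
  have hcoe := fun u => coe_toReal_inf_coe (hbot u) c
  have hlsc : LowerSemicontinuous fun u => (f u ⊓ (c : EReal)).toReal :=
    lowerSemicontinuous_toReal (hf.inf lowerSemicontinuous_const)
      (fun u => hcoe u ▸ EReal.coe_ne_bot _) (fun u => hcoe u ▸ EReal.coe_ne_top _)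
  obtain ⟨ξ, hξ, hneg⟩ := hV.exists_mem_limitingSubdiff_coe hlsc hg hg_lip
    (isLocalMin_toReal_inf_add hbot hg_lip.continuous.continuousAt hxc hmin)
  simp only [hcoe] at hξ
  exact ⟨ξ, limitingSubdiff_inf_subset hxc hξ, hneg⟩

end ExtendedReal

section VariationalSumRule

variable {V : Type*} [NormedAddCommGroup V] [NormedSpace ℝ V] {T t : ℝ} {D : Set V}
  {E : ℝ → V → EReal} {F : ℝ → V → Set (StrongDual ℝ V)}

theorem IsWeaklyClosedPair.limitingSubdiff_subset (hclosed : IsWeaklyClosedPair T D E F)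
    (ht : t ∈ Icc 0 T) (hdom : ∀ u, E t u ≠ ⊤ ↔ u ∈ D)
    (hsub : ∀ u ∈ D, frechetSubdiff (E t) u ⊆ F t u) {u : V} (hu : u ∈ D) (hbot : E t u ≠ ⊥) :
    limitingSubdiff (E t) u ⊆ F t u := by
  rintro ξ ⟨us, ξs, hξs, hus, hEus, hξ⟩
  have hmem : ∀ n, us n ∈ D := fun n => (hdom _).1 (hξs n).1
  obtain ⟨-, hξF, -⟩ := hclosed t ht us ξs (fun n => (E t (us n)).toReal) u ξ (E t u).toReal
    (fun n => ⟨ht, hmem n, hsub _ (hmem n) (hξs n)⟩)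
    (fun n => EReal.coe_toReal (hξs n).1 (hξs n).2.1) hus hξ
    ((EReal.tendsto_toReal ((hdom u).2 hu) hbot).comp hEus)
  exact hξF

section Rescaling

variable {ψ : V → ℝ} {τ : ℝ}

theorem convexOn_mul_comp_smul_sub (hψ : ConvexOn ℝ univ ψ) (hτ : 0 ≤ τ) (u₀ : V) :
    ConvexOn ℝ univ fun u => τ * ψ (τ⁻¹ • (u - u₀)) := by
  let rescale : V →ᵃ[ℝ] V := τ⁻¹ • (AffineMap.id ℝ V - AffineMap.const ℝ V u₀)
  exact (hψ.comp_affineMap rescale).smul hτ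

theorem lowerSemicontinuous_mul_comp_smul_sub (hψ : LowerSemicontinuous ψ) (hτ : 0 ≤ τ) (u₀ : V) :
    LowerSemicontinuous fun u => τ * ψ (τ⁻¹ • (u - u₀)) := by
  have hrescale : Continuous fun u : V => τ⁻¹ • (u - u₀) := by fun_prop
  exact (continuous_const_mul τ).comp_lowerSemicontinuous (hψ.comp hrescale)
    fun _ _ hab => mul_le_mul_of_nonneg_left hab hτ

theorem mem_convexSubdiff_of_rescaled (hτ : 0 < τ) {u₀ u : V} {η : StrongDual ℝ V}
    (hη : η ∈ convexSubdiff (fun u => τ * ψ (τ⁻¹ • (u - u₀))) u) :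
    η ∈ convexSubdiff ψ (τ⁻¹ • (u - u₀)) := by
  intro z
  have hdir : u₀ + τ • z - u = τ • (z - τ⁻¹ • (u - u₀)) := by
    rw [smul_sub, smul_inv_smul₀ hτ.ne']
    abel
  have hle := hη (u₀ + τ • z)
  beta_reduce at hle
  rw [add_sub_cancel_left, inv_smul_smul₀ hτ.ne', hdir, map_smul, smul_eq_mul, ← mul_add] at hle
  exact le_of_mul_le_mul_left hle hτ

end Rescaling

namespace IsEnergy

theorem ne_bot (hE : IsEnergy T D E F) (ht : t ∈ Icc 0 T) (u : V) : E t u ≠ ⊥ := by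
  obtain ⟨C₀, -, hlow⟩ := hE.bounded_below
  by_cases hu : u ∈ D
  · exact ne_bot_of_le_ne_bot (EReal.coe_ne_bot C₀) (hlow t ht u hu)
  · have htop : E t u = ⊤ := by rwa [← not_not (a := E t u = ⊤), ← ne_eq, hE.dom_eq t ht]
    exact htop ▸ top_ne_bot

theorem mem_of_isMinOn (hE : IsEnergy T D E F) (ht : t ∈ Icc 0 T) {g : V → ℝ} {u : V}
    (hmin : IsMinOn (fun v => E t v + (g v : EReal)) univ u) : u ∈ D := by
  obtain ⟨w, hw⟩ := hE.dom_nonempty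
  rw [← hE.dom_eq t ht] at hw ⊢
  intro htop
  have hle : E t u + (g u : EReal) ≤ E t w + (g w : EReal) := hmin (mem_univ w)
  rw [htop, EReal.top_add_coe, top_le_iff] at hle
  exact EReal.add_ne_top hw (EReal.coe_ne_top _) hle

end IsEnergy

theorem proposition4_general [CompleteSpace V] [TopologicalSpace.SeparableSpace V]
    (hV : IsReflexiveSpace V) (ht : t ∈ Icc 0 T) (hdom : ∀ u, E t u ≠ ⊤ ↔ u ∈ D)
    (hlsc : LowerSemicontinuous (E t)) (hbot : ∀ u, E t u ≠ ⊥)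
    (hsub : ∀ u ∈ D, frechetSubdiff (E t) u ⊆ F t u) (hclosed : IsWeaklyClosedPair T D E F)
    {ψ : V → ℝ} (hψ : ConvexOn ℝ univ ψ) (hψ_lsc : LowerSemicontinuous ψ) {u₀ ubar : V} {τ : ℝ}
    (hτ : 0 < τ) (hubar : ubar ∈ D)
    (hmin : IsLocalMin (fun u => E t u + ((τ * ψ (τ⁻¹ • (u - u₀)) : ℝ) : EReal)) ubar) :
    ∃ ξ ∈ F t ubar, -ξ ∈ convexSubdiff ψ (τ⁻¹ • (ubar - u₀)) := by
  obtain ⟨ξ, hξ, hneg⟩ := hV.exists_mem_limitingSubdiff hlsc hbot ((hdom ubar).2 hubar)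
    (convexOn_mul_comp_smul_sub hψ hτ.le u₀) (lowerSemicontinuous_mul_comp_smul_sub hψ_lsc hτ.le u₀)
    hmin
  exact ⟨ξ, hclosed.limitingSubdiff_subset ht hdom hsub hubar (hbot ubar) hξ,
    mem_convexSubdiff_of_rescaled hτ hneg⟩

end VariationalSumRule

theorem proposition4 {V : Type*} [NormedAddCommGroup V] [NormedSpace ℝ V] [CompleteSpace V]
    [TopologicalSpace.SeparableSpace V] (hV : IsReflexiveSpace V)
    (T : ℝ) (D : Set V) (E : ℝ → V → EReal) (F : ℝ → V → Set (StrongDual ℝ V))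
    (S : Set V) (Ψ : V → V → ℝ)
    (hΨ : ∀ w ∈ S, IsAdmissiblePotential (Ψ w))
    (hE : IsEnergy T D E F)
    (hsub : ∀ t ∈ Set.Icc 0 T, ∀ u ∈ D, frechetSubdiff (E t) u ⊆ F t u)
    (hclosed : IsWeaklyClosedPair T D E F) :
    ∀ t ∈ Set.Icc 0 T, ∀ u₀ ∈ S, ∀ τ : ℝ, 0 < τ → ∀ ubar : V,
      IsMinOn (fun u => E t u + ((τ * Ψ u₀ (τ⁻¹ • (u - u₀)) : ℝ) : EReal)) Set.univ ubar →
      ∃ ξ ∈ F t ubar, -ξ ∈ convexSubdiff (Ψ u₀) (τ⁻¹ • (ubar - u₀)) :=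
  fun t ht u₀ hu₀ _ hτ _ hmin =>
    proposition4_general hV ht (hE.dom_eq t ht) (hE.lsc t ht) (hE.ne_bot ht) (hsub t ht) hclosed
      (hΨ u₀ hu₀).convex (hΨ u₀ hu₀).lsc hτ (hE.mem_of_isMinOn ht hmin) (hmin.isLocalMin univ_mem)
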